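/- Let $(\Omega,\mathcal F,\mathbb P)$ be a probability space carrying a space-time white noise $W$, i.e. a centered Gaussian process $(W(t,A))$, indexed by $t\ge 0$ and bounded Borel sets $A\subset\mathbb R$, with $\mathbb E[W(t,A)W(t',A')]=(t\wedge t')\,\lambda(A\cap A')$, $\lambda$ being Lebesgue measure. Let $T>0$ and, for $t\in[0,T]$, $x\in\mathbb R$, let $$u(t,x)=\int_0^t\int_{\mathbb R}G(t-s,x-y)\,dW(s,y)\quad\text{a.s.},\qquad G(t,x)=\begin{cases}(2\pi t)^{-1/2}e^{-x^2/(2t)}&t>0,\\0&t\le 0,\end{cases}$$ (Wiener integral) be the mild solution of $\partial_t u=\tfrac12\partial_x^2u+\frac{\partial^2W}{\partial t\,\partial x}$, $u(0,\cdot)=0$. Write $I=[0,1]$, $\mathcal N(x)=e^{x^2}-1$, let $L_{\mathcal N}$ be the space of measurable $f:I\to\mathbb R$ with $\inf_{\lambda>0}\frac1\lambda\left[1+\int_I\mathcal N(\lambda f(x))\,dx\right]<\infty$, and put, for real $p\ge 1$ and $t>0$, $$\|f\|_{\mathcal N}=\sup_{p\ge1}\frac{\|f\|_{L^p(I)}}{\sqrt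 p},\qquad \Delta_p(f)(t)=\sup_{|s|\le t}\Big(\int_{\{x\in I:\,x+s\in I\}}|f(x+s)-f(x)|^p\,dx\Big)^{1/p},\qquad \Delta_{\mathcal N}(f)(t)=\sup_{p\ge1}\frac{\Delta_p(f)(t)}{\sqrt p}.$$ For $0<\alpha<1$ let $$\mathcal B^{\alpha}_{\mathcal N}=\Big\{f\in L_{\mathcal N}:\ \|f\|_{\mathcal N}+\sup_{0<t\le1}t^{-\alpha}\Delta_{\mathcal N}(f)(t)<\infty\Big\},\qquad \mathcal B^{\alpha,0}_{\mathcal N}=\big\{f\in L_{\mathcal N}:\ \Delta_{\mathcal N}(f)(t)=o(t^\alpha)\text{ as }t\to0^+\big\}.$$ **Theorem.** Fix $t\in(0,T]$, and let $u(t,\cdot)$ be taken in a version for which $(x,\omega)\mapsto u(t,x)(\omega)$ is measurable on $[0,1]\times\Omega$ up to a $dx\otimes\mathbb P$-null set (for instance, a version with almost surely continuous paths). Then $$\mathbb P\big[u(t,\cdot)\in\mathcal B^{1/2}_{\mathcal N}\big]=1\qquad\text{and}\qquad \mathbb P\big[u(t,\cdot)\in\mathcal B^{1/2,0}_{\mathcal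 N}\big]=0,$$ where $u(t,\cdot)$ denotes the sample path $x\in[0,1]\mapsto u(t,x)$. -/

import Mathlib

open MeasureTheory ProbabilityTheory Set Filter Topology
open scoped ENNReal NNReal

noncomputable section

/-! ### Besov–Orlicz spaces for the Young function `x ↦ exp (x ^ 2) - 1`

All norms and moduli take values in `[0, ∞]`, so that a supremum or an integral is `∞` exactly
when it diverges. -/

/-- The set `I_s = {x ∈ I ; x + s ∈ I}`. -/
def shiftDomain (I : Set ℝ) (s : ℝ) : Set ℝ := {x | x ∈ I ∧ x + s ∈ I}

/-- The `L^p` modulus of continuity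
`Δ_p(f, I)(t) = sup_{|s| ≤ t} (∫_{I_s} |f (x + s) - f x| ^ p dx) ^ (1 / p)`. -/
def lpModulus (p : ℝ) (f : ℝ → ℝ) (I : Set ℝ) (t : ℝ) : ℝ≥0∞ :=
  ⨆ (s : ℝ) (_ : |s| ≤ t),
    eLpNorm (fun x => f (x + s) - f x) (ENNReal.ofReal p) (volume.restrict (shiftDomain I s))

/-- The Young function `N(x) = exp (x ^ 2) - 1`. -/
def youngN (x : ℝ) : ℝ := Real.exp (x ^ 2) - 1

/-- The Orlicz norm `‖f‖*_N = inf_{l > 0} (1 / l) (1 + ∫_I N (l f(x)) dx)`. -/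
def orliczNormStar (f : ℝ → ℝ) (I : Set ℝ) : ℝ≥0∞ :=
  ⨅ (l : ℝ) (_ : 0 < l),
    ENNReal.ofReal (1 / l) * (1 + ∫⁻ x in I, ENNReal.ofReal (youngN (l * f x)))

/-- `f` belongs to the Orlicz space `L_N(I)`. -/
def MemOrlicz (f : ℝ → ℝ) (I : Set ℝ) : Prop :=
  AEMeasurable f (volume.restrict I) ∧ orliczNormStar f I < ∞

/-- The equivalent norm `‖f‖_N = sup_{p ≥ 1} ‖f‖_{L^p(I)} / √p` (`p` real). -/
def orliczNorm (f : ℝ → ℝ) (I : Set ℝ) : ℝ≥0∞ :=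
  ⨆ (p : ℝ) (_ : 1 ≤ p),
    eLpNorm f (ENNReal.ofReal p) (volume.restrict I) / ENNReal.ofReal (Real.sqrt p)

/-- The Orlicz modulus of continuity `Δ_N(f, I)(t) = sup_{p ≥ 1} Δ_p(f, I)(t) / √p`. -/
def orliczModulus (f : ℝ → ℝ) (I : Set ℝ) (t : ℝ) : ℝ≥0∞ :=
  ⨆ (p : ℝ) (_ : 1 ≤ p), lpModulus p f I t / ENNReal.ofReal (Real.sqrt p)

/-- The norm `‖f‖_{α, N} = ‖f‖_N + sup_{0 < t ≤ 1} Δ_N(f, I)(t) / t ^ α`. -/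
def besovOrliczNorm (α : ℝ) (f : ℝ → ℝ) (I : Set ℝ) : ℝ≥0∞ :=
  orliczNorm f I +
    ⨆ (t : ℝ) (_ : t ∈ Ioc (0 : ℝ) 1), orliczModulus f I t / ENNReal.ofReal (t ^ α)

/-- `f` belongs to the Besov–Orlicz space `B^α_N(I)`. -/
def MemBesovOrlicz (α : ℝ) (f : ℝ → ℝ) (I : Set ℝ) : Prop :=
  MemOrlicz f I ∧ besovOrliczNorm α f I < ∞

/-- `f` belongs to `B^{α,0}_N(I)`: `f ∈ L_N(I)` and `Δ_N(f, I)(t) = o(t ^ α)` as `t → 0+`. -/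
def MemBesovOrliczZero (α : ℝ) (f : ℝ → ℝ) (I : Set ℝ) : Prop :=
  MemOrlicz f I ∧
    Tendsto (fun t : ℝ => orliczModulus f I t / ENNReal.ofReal (t ^ α)) (𝓝[>] 0) (𝓝 0)

/-! ### Space-time white noise, the Wiener integral and the mild solution -/

/-- Bounded Borel subsets of the real line. -/
abbrev BddBorelSet : Type := {A : Set ℝ // MeasurableSet A ∧ Bornology.IsBounded A}

/-- `W(t, A)`, for `t ≥ 0` and bounded Borel `A`, is a space-time white noise on `(Ω, P)`: a
centered Gaussian process with `E[W(t, A) W(t', A')] = (t ∧ t') λ(A ∩ A')`. -/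
structure IsSpaceTimeWhiteNoise {Ω : Type*} [MeasurableSpace Ω]
    (W : ℝ≥0 → BddBorelSet → Ω → ℝ) (P : Measure Ω) : Prop where
  isGaussianProcess : IsGaussianProcess (fun q : ℝ≥0 × BddBorelSet => W q.1 q.2) P
  centered : ∀ (t : ℝ≥0) (A : BddBorelSet), ∫ ω, W t A ω ∂P = 0
  covariance : ∀ (t t' : ℝ≥0) (A A' : BddBorelSet),
    ∫ ω, W t A ω * W t' A' ω ∂P
      = ((min t t' : ℝ≥0) : ℝ) * (volume ((A : Set ℝ) ∩ (A' : Set ℝ))).toReal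

/-- The elementary function `(s, y) ↦ ∑ c_i 1_{(0, t_i] × A_i}(s, y)` with coefficients `c`. -/
def elementaryFun (c : (ℝ≥0 × BddBorelSet) →₀ ℝ) (z : ℝ × ℝ) : ℝ :=
  c.sum fun q a => a * (Ioc (0 : ℝ) (q.1 : ℝ) ×ˢ (q.2 : Set ℝ)).indicator (fun _ => (1 : ℝ)) z

/-- The integral `∑ c_i W(t_i, A_i)` of an elementary function against `W`. -/
def elementaryIntegral {Ω : Type*} (W : ℝ≥0 → BddBorelSet → Ω → ℝ)
    (c : (ℝ≥0 × BddBorelSet) →₀ ℝ) (ω : Ω) : ℝ :=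
  c.sum fun q a => a * W q.1 q.2 ω

/-- `X` is (a version of) the Wiener integral `∫∫ φ(s, y) dW(s, y)`: there are elementary
functions converging to `φ` in `L²(ds dy)` whose integrals against `W` converge to `X`
in `L²(P)`. -/
def IsWienerIntegral {Ω : Type*} [MeasurableSpace Ω] (W : ℝ≥0 → BddBorelSet → Ω → ℝ)
    (P : Measure Ω) (φ : ℝ × ℝ → ℝ) (X : Ω → ℝ) : Prop :=
  ∃ c : ℕ → ((ℝ≥0 × BddBorelSet) →₀ ℝ),
    Tendsto (fun n => eLpNorm (fun z => elementaryFun (c n) z - φ z) 2 volume) atTop (𝓝 0) ∧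
    Tendsto (fun n => eLpNorm (fun ω => elementaryIntegral W (c n) ω - X ω) 2 P) atTop (𝓝 0)

/-- The Green kernel of `∂_t - (1/2) ∂_x²`. -/
def greenKernel (t x : ℝ) : ℝ :=
  if 0 < t then (Real.sqrt (2 * Real.pi * t))⁻¹ * Real.exp (-(|x| ^ 2 / (2 * t))) else 0

/-- `u(t, x) = ∫_0^t ∫_ℝ G(t - s, x - y) dW(s, y)` a.s., for every `t ∈ [0, T]` and `x ∈ ℝ`:
`u` is (a version of) the mild solution of `∂_t u = (1/2) ∂_x² u + ∂_t ∂_x W`, `u(0, ·) = 0`. -/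
def IsMildSolution {Ω : Type*} [MeasurableSpace Ω] (W : ℝ≥0 → BddBorelSet → Ω → ℝ)
    (P : Measure Ω) (T : ℝ) (u : ℝ → ℝ → Ω → ℝ) : Prop :=
  ∀ t ∈ Icc (0 : ℝ) T, ∀ x : ℝ,
    IsWienerIntegral W P
      ((Ioc (0 : ℝ) t ×ˢ (univ : Set ℝ)).indicator
        fun z : ℝ × ℝ => greenKernel (t - z.1) (x - z.2))
      (u t x)

end

/-! ### Wiener integrals are centered Gaussian and isometric -/

/-! At a fixed time `t` the field is centered Gaussian in `x`, with covariance `R(|x - y|)`, where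
`R = mildCov t` is smooth, `R' ≥ -1/2` on `[0, ∞)`, `R'(0) = -1/2` and `R''` is the bounded heat
kernel at time `2t`. Spatially it therefore looks like Brownian motion: an increment over `h` has
variance between `h - O(h²)` and `h`, and two increments with base points at least `h` apart have
covariance `O(h²)`.

For `h = 2^(-k)` consider the spatial average of `exp (a (u(x + h) - u(x))² / h)` with `a = ±1/16`.
Its mean is explicit. The decoupling bound `IsWienerIntegral.lintegral_exp_mul_sq_mul` makes its
variance `O(h)`, which is summable in `k`, so the average minus its mean tends to `0` almost surely
(`ae_tendsto_dyadicExpAverage_sub`).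

For `a = 1/16` the averages are bounded in `k`. This bounds the `L^p` norm of dyadic increments by
`C √p √h` for all `p` at once, and subadditivity in the shift extends the bound to every shift
(`memBesovOrlicz_of_lintegral_exp_le`).

For `a = -1/16` the averages stay below the length of the domain by a fixed amount. Since `1 - exp
(-y) ≤ y`, the mean square of the increments is at least a constant times `h`, so the exponent `p =
2` alone excludes `o(√h)` (`not_memBesovOrliczZero_of_le_lintegral_sq`). -/

theorem elementaryFun_add (c d : (ℝ≥0 × BddBorelSet) →₀ ℝ) (z : ℝ × ℝ) :
    elementaryFun (c + d) z = elementaryFun c z + elementaryFun d z :=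
  Finsupp.sum_add_index' (by simp) (by intros; ring)

theorem elementaryFun_smul (r : ℝ) (c : (ℝ≥0 × BddBorelSet) →₀ ℝ) (z : ℝ × ℝ) :
    elementaryFun (r • c) z = r * elementaryFun c z := by
  unfold elementaryFun
  rw [Finsupp.sum_smul_index (by simp), Finsupp.mul_sum]
  simp only [mul_assoc]

theorem elementaryIntegral_add {Ω : Type*} (W : ℝ≥0 → BddBorelSet → Ω → ℝ)
    (c d : (ℝ≥0 × BddBorelSet) →₀ ℝ) (ω : Ω) :
    elementaryIntegral W (c + d) ω = elementaryIntegral W c ω + elementaryIntegral W d ω :=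
  Finsupp.sum_add_index' (by simp) (by intros; ring)

theorem elementaryIntegral_smul {Ω : Type*} (W : ℝ≥0 → BddBorelSet → Ω → ℝ)
    (r : ℝ) (c : (ℝ≥0 × BddBorelSet) →₀ ℝ) (ω : Ω) :
    elementaryIntegral W (r • c) ω = r * elementaryIntegral W c ω := by
  unfold elementaryIntegral
  rw [Finsupp.sum_smul_index (by simp), Finsupp.mul_sum]
  simp only [mul_assoc]

theorem measurableSet_elementary_box (q : ℝ≥0 × BddBorelSet) :
    MeasurableSet (Ioc (0 : ℝ) (q.1 : ℝ) ×ˢ (q.2 : Set ℝ)) :=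
  measurableSet_Ioc.prod q.2.2.1

theorem volume_elementary_box_ne_top (q : ℝ≥0 × BddBorelSet) :
    volume (Ioc (0 : ℝ) (q.1 : ℝ) ×ˢ (q.2 : Set ℝ)) ≠ ∞ := by
  rw [Measure.volume_eq_prod, Measure.prod_prod]
  exact ENNReal.mul_ne_top (by simp) q.2.2.2.measure_lt_top.ne

theorem memLp_elementaryFun (c : (ℝ≥0 × BddBorelSet) →₀ ℝ) :
    MemLp (elementaryFun c) 2 volume := by
  unfold elementaryFun Finsupp.sum
  exact memLp_finsetSum _ fun q _ =>
    (memLp_indicator_const 2 (measurableSet_elementary_box q) 1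
      (Or.inr (volume_elementary_box_ne_top q))).const_mul _

/-- Two boxes starting at time `0` meet in a box of the same kind, so this inner product is the
white-noise covariance; this is the source of the isometry. -/
theorem integral_elementary_box_mul (q r : ℝ≥0 × BddBorelSet) :
    ∫ z : ℝ × ℝ, (Ioc (0 : ℝ) (q.1 : ℝ) ×ˢ (q.2 : Set ℝ)).indicator (fun _ => (1 : ℝ)) z *
        (Ioc (0 : ℝ) (r.1 : ℝ) ×ˢ (r.2 : Set ℝ)).indicator (fun _ => (1 : ℝ)) z =
      ((min q.1 r.1 : ℝ≥0) : ℝ) * (volume ((q.2 : Set ℝ) ∩ (r.2 : Set ℝ))).toReal := by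
  have h : (fun z : ℝ × ℝ =>
      (Ioc (0 : ℝ) (q.1 : ℝ) ×ˢ (q.2 : Set ℝ)).indicator (fun _ => (1 : ℝ)) z *
        (Ioc (0 : ℝ) (r.1 : ℝ) ×ˢ (r.2 : Set ℝ)).indicator (fun _ => (1 : ℝ)) z) =
      (Ioc (0 : ℝ) ((min q.1 r.1 : ℝ≥0) : ℝ) ×ˢ ((q.2 : Set ℝ) ∩ (r.2 : Set ℝ))).indicator
        (fun _ => (1 : ℝ)) := by
    rw [NNReal.coe_min, ← min_self (0 : ℝ), min_self (0 : ℝ)]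
    have e : Ioc (0 : ℝ) (min (q.1 : ℝ) r.1) = Ioc 0 (q.1 : ℝ) ∩ Ioc 0 (r.1 : ℝ) := by
      rw [Ioc_inter_Ioc]; simp
    rw [e, ← prod_inter_prod, ← Pi.one_def, inter_indicator_one]
    rfl
  rw [h, integral_indicator_const _ (measurableSet_Ioc.prod (q.2.2.1.inter r.2.2.1)),
    Measure.real, Measure.volume_eq_prod, Measure.prod_prod, ENNReal.toReal_mul,
    Real.volume_Ioc, sub_zero, ENNReal.toReal_ofReal (NNReal.coe_nonneg _), smul_eq_mul, mul_one]

theorem integral_sq_elementaryFun (c : (ℝ≥0 × BddBorelSet) →₀ ℝ) :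
    ∫ z, elementaryFun c z ^ 2 = ∑ q ∈ c.support, ∑ r ∈ c.support,
      c q * c r * (((min q.1 r.1 : ℝ≥0) : ℝ) *
        (volume ((q.2 : Set ℝ) ∩ (r.2 : Set ℝ))).toReal) := by
  have hb : ∀ q : ℝ≥0 × BddBorelSet, MemLp (fun z : ℝ × ℝ =>
      (Ioc (0 : ℝ) (q.1 : ℝ) ×ˢ (q.2 : Set ℝ)).indicator (fun _ => (1 : ℝ)) z) 2 volume :=
    fun q => memLp_indicator_const 2 (measurableSet_elementary_box q) 1
      (Or.inr (volume_elementary_box_ne_top q))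
  have hi : ∀ q r : ℝ≥0 × BddBorelSet, Integrable (fun z : ℝ × ℝ =>
      c q * c r * ((Ioc (0 : ℝ) (q.1 : ℝ) ×ˢ (q.2 : Set ℝ)).indicator (fun _ => (1 : ℝ)) z *
        (Ioc (0 : ℝ) (r.1 : ℝ) ×ˢ (r.2 : Set ℝ)).indicator (fun _ => (1 : ℝ)) z)) :=
    fun q r => ((hb q).integrable_mul (hb r)).const_mul _
  simp_rw [← integral_elementary_box_mul, ← integral_const_mul]
  simp_rw [← integral_finsetSum _ fun r _ => hi _ r]
  rw [← integral_finsetSum _ fun q _ => integrable_finsetSum _ fun r _ => hi q r]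
  congr 1 with z
  rw [elementaryFun, Finsupp.sum, sq, Finset.sum_mul_sum]
  exact Finset.sum_congr rfl fun q _ => Finset.sum_congr rfl fun r _ => by ring

/-- The second moment is a squared `L²` norm, and the norm is continuous. -/
theorem tendsto_integral_sq_of_tendsto_eLpNorm {α : Type*} [MeasurableSpace α] {μ : Measure α}
    {f : ℕ → α → ℝ} {g : α → ℝ} (hf : ∀ n, MemLp (f n) 2 μ) (hg : MemLp g 2 μ)
    (h : Tendsto (fun n => eLpNorm (fun z => f n z - g z) 2 μ) atTop (𝓝 0)) :
    Tendsto (fun n => ∫ z, f n z ^ 2 ∂μ) atTop (𝓝 (∫ z, g z ^ 2 ∂μ)) := by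
  have key : ∀ {k : α → ℝ} (hk : MemLp k 2 μ), ∫ z, k z ^ 2 ∂μ = ‖hk.toLp k‖ ^ 2 := by
    intro k hk
    rw [← real_inner_self_eq_norm_sq, L2.inner_def]
    refine integral_congr_ae ?_
    filter_upwards [hk.coeFn_toLp] with z hz
    simp [hz, sq]
  rw [key hg]
  simp_rw [fun n => key (hf n)]
  exact ((Lp.tendsto_Lp_iff_tendsto_eLpNorm'' f hf g hg).2 h).norm.pow 2

/-! ### Gaussian laws of elementary and Wiener integrals -/

section WienerIntegral

variable {Ω : Type*} [MeasurableSpace Ω] {P : Measure Ω} {W : ℝ≥0 → BddBorelSet → Ω → ℝ}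

theorem IsSpaceTimeWhiteNoise.hasGaussianLaw (hW : IsSpaceTimeWhiteNoise W P)
    (q : ℝ≥0 × BddBorelSet) : HasGaussianLaw (W q.1 q.2) P :=
  (hW.isGaussianProcess.hasGaussianLaw {q}).eval ⟨q, by simp⟩

theorem hasGaussianLaw_elementaryIntegral (hW : IsSpaceTimeWhiteNoise W P)
    (c : (ℝ≥0 × BddBorelSet) →₀ ℝ) : HasGaussianLaw (elementaryIntegral W c) P := by
  have h := (hW.isGaussianProcess.hasGaussianLaw c.support).map_fun
    (∑ q : c.support, c q • ContinuousLinearMap.proj (R := ℝ) (φ := fun _ : c.support => ℝ) q)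
  convert! h using 1
  ext ω
  rw [elementaryIntegral, Finsupp.sum, _root_.sum_apply, ← Finset.sum_coe_sort]
  rfl

theorem integral_elementaryIntegral (hW : IsSpaceTimeWhiteNoise W P)
    (c : (ℝ≥0 × BddBorelSet) →₀ ℝ) : ∫ ω, elementaryIntegral W c ω ∂P = 0 := by
  unfold elementaryIntegral Finsupp.sum
  rw [integral_finsetSum _ fun q _ => (hW.hasGaussianLaw q).integrable.const_mul _]
  simp [integral_const_mul, hW.centered]

theorem integral_sq_elementaryIntegral (hW : IsSpaceTimeWhiteNoise W P)
    (c : (ℝ≥0 × BddBorelSet) →₀ ℝ) :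
    ∫ ω, elementaryIntegral W c ω ^ 2 ∂P = ∫ z, elementaryFun c z ^ 2 := by
  have hi : ∀ q r : ℝ≥0 × BddBorelSet,
      Integrable (fun ω => c q * c r * (W q.1 q.2 ω * W r.1 r.2 ω)) P := fun q r =>
    ((hW.hasGaussianLaw q).memLp_two.integrable_mul (hW.hasGaussianLaw r).memLp_two).const_mul _
  rw [integral_sq_elementaryFun]
  simp_rw [← hW.covariance, ← integral_const_mul]
  simp_rw [← integral_finsetSum _ fun r _ => hi _ r]
  rw [← integral_finsetSum _ fun q _ => integrable_finsetSum _ fun r _ => hi q r]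
  congr 1 with ω
  rw [elementaryIntegral, Finsupp.sum, sq, Finset.sum_mul_sum]
  exact Finset.sum_congr rfl fun q _ => Finset.sum_congr rfl fun r _ => by ring

theorem map_elementaryIntegral (hW : IsSpaceTimeWhiteNoise W P)
    (c : (ℝ≥0 × BddBorelSet) →₀ ℝ) :
    P.map (elementaryIntegral W c) = gaussianReal 0 (∫ z, elementaryFun c z ^ 2).toNNReal := by
  have h := hasGaussianLaw_elementaryIntegral hW c
  rw [h.map_eq_gaussianReal, integral_elementaryIntegral hW,
    variance_of_integral_eq_zero h.aemeasurable (integral_elementaryIntegral hW c),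
    integral_sq_elementaryIntegral hW]

/-- An elementary function lies at finite `L²` distance from `φ`. Square integrability of the Green
kernel thus comes with the existence of the integral and needs no computation. -/
theorem IsWienerIntegral.memLp {φ : ℝ × ℝ → ℝ} {X : Ω → ℝ} (h : IsWienerIntegral W P φ X)
    (hφ : Measurable φ) : MemLp φ 2 volume := by
  obtain ⟨c, hc, -⟩ := h
  obtain ⟨n, hn⟩ := (hc.eventually_lt_const (u := 1) (by simp)).exists
  have h1 : MemLp (fun z => elementaryFun (c n) z - φ z) 2 volume :=
    ⟨(memLp_elementaryFun _).1.sub hφ.aestronglyMeasurable, hn.trans ENNReal.one_lt_top⟩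
  have h2 := (memLp_elementaryFun (c n)).sub h1
  convert! h2 using 1
  ext z; simp

/-- Convergence in `L²(P)` gives convergence in law, while the approximating laws are Gaussian with
variances converging by the isometry; characteristic functions identify the limit. -/
theorem IsWienerIntegral.map_eq (hW : IsSpaceTimeWhiteNoise W P) {φ : ℝ × ℝ → ℝ} {X : Ω → ℝ}
    (h : IsWienerIntegral W P φ X) (hφ : Measurable φ) (hX : AEMeasurable X P) :
    P.map X = gaussianReal 0 (∫ z, φ z ^ 2).toNNReal := by
  have hP : IsProbabilityMeasure P :=
    (hasGaussianLaw_elementaryIntegral hW 0).isProbabilityMeasure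
  have hφ2 := h.memLp hφ
  obtain ⟨c, hc, hI⟩ := h
  have hm : ∀ n, AEMeasurable (elementaryIntegral W (c n)) P := fun n =>
    (hasGaussianLaw_elementaryIntegral hW (c n)).aemeasurable
  have hd := (tendstoInMeasure_of_tendsto_eLpNorm two_ne_zero
    (fun n => (hm n).aestronglyMeasurable) hX.aestronglyMeasurable hI).tendstoInDistribution hm
  have := Measure.isProbabilityMeasure_map (μ := P) hX
  refine Measure.ext_of_charFun (funext fun θ => ?_)
  refine tendsto_nhds_unique (ProbabilityMeasure.tendsto_iff_tendsto_charFun.1 hd.tendsto θ) ?_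
  simp only [ProbabilityMeasure.coe_mk, map_elementaryIntegral hW, charFun_gaussianReal]
  have hv := tendsto_integral_sq_of_tendsto_eLpNorm (fun n => memLp_elementaryFun (c n)) hφ2 hc
  have hv' := (continuous_real_toNNReal.tendsto _).comp hv
  have hcont : Continuous fun v : ℝ≥0 =>
      Complex.exp (θ * ((0 : ℝ) : ℂ) * Complex.I - ((v : ℝ) : ℂ) * (θ : ℂ) ^ 2 / 2) := by
    fun_prop
  exact (hcont.tendsto _).comp hv'

theorem IsWienerIntegral.add (hW : IsSpaceTimeWhiteNoise W P) {φ ψ : ℝ × ℝ → ℝ} {X Y : Ω → ℝ}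
    (hX : IsWienerIntegral W P φ X) (hY : IsWienerIntegral W P ψ Y)
    (hφ : Measurable φ) (hψ : Measurable ψ) (hXm : AEMeasurable X P) (hYm : AEMeasurable Y P) :
    IsWienerIntegral W P (fun z => φ z + ψ z) (fun ω => X ω + Y ω) := by
  obtain ⟨c, hc, hI⟩ := hX
  obtain ⟨d, hd, hJ⟩ := hY
  have hm := fun e => (hasGaussianLaw_elementaryIntegral hW e).aemeasurable.aestronglyMeasurable
  refine ⟨fun n => c n + d n, ?_, ?_⟩
  · refine tendsto_of_tendsto_of_tendsto_of_le_of_le tendsto_const_nhds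
      (by simpa using hc.add hd) (fun _ => zero_le) fun n => ?_
    convert! eLpNorm_add_le ((memLp_elementaryFun (c n)).1.sub hφ.aestronglyMeasurable)
      ((memLp_elementaryFun (d n)).1.sub hψ.aestronglyMeasurable) one_le_two using 2
    ext z; simp [elementaryFun_add]; ring
  · refine tendsto_of_tendsto_of_tendsto_of_le_of_le tendsto_const_nhds
      (by simpa using hI.add hJ) (fun _ => zero_le) fun n => ?_
    convert! eLpNorm_add_le ((hm (c n)).sub hXm.aestronglyMeasurable)
      ((hm (d n)).sub hYm.aestronglyMeasurable) one_le_two using 2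
    ext z; simp [elementaryIntegral_add]; ring

theorem IsWienerIntegral.const_mul {φ : ℝ × ℝ → ℝ} {X : Ω → ℝ}
    (hX : IsWienerIntegral W P φ X) (r : ℝ) :
    IsWienerIntegral W P (fun z => r * φ z) (fun ω => r * X ω) := by
  obtain ⟨c, hc, hI⟩ := hX
  refine ⟨fun n => r • c n, ?_, ?_⟩
  · have h := ENNReal.Tendsto.const_mul (a := ‖r‖ₑ) hc (Or.inr enorm_ne_top)
    simp_rw [elementaryFun_smul, ← mul_sub]
    simpa [← eLpNorm_const_smul, Pi.smul_def] using h
  · have h := ENNReal.Tendsto.const_mul (a := ‖r‖ₑ) hI (Or.inr enorm_ne_top)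
    simp_rw [elementaryIntegral_smul, ← mul_sub]
    simpa [← eLpNorm_const_smul, Pi.smul_def] using h

/-- Every linear functional of the pair is again a Wiener integral, hence Gaussian. -/
theorem IsWienerIntegral.hasGaussianLaw_pair (hW : IsSpaceTimeWhiteNoise W P)
    {φ ψ : ℝ × ℝ → ℝ} {X Y : Ω → ℝ}
    (hX : IsWienerIntegral W P φ X) (hY : IsWienerIntegral W P ψ Y)
    (hφ : Measurable φ) (hψ : Measurable ψ) (hXm : AEMeasurable X P) (hYm : AEMeasurable Y P) :
    HasGaussianLaw (fun ω => (X ω, Y ω)) P := by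
  refine ⟨isGaussian_of_map_eq_gaussianReal fun L => ?_⟩
  have hL : (fun ω => L (X ω, Y ω)) = fun ω => L (1, 0) * X ω + L (0, 1) * Y ω := by
    ext ω
    have : (X ω, Y ω) = X ω • ((1 : ℝ), (0 : ℝ)) + Y ω • ((0 : ℝ), (1 : ℝ)) := by simp
    rw [this, map_add, map_smul, map_smul, smul_eq_mul, smul_eq_mul]; ring
  rw [AEMeasurable.map_map_of_aemeasurable (by fun_prop) (hXm.prodMk hYm)]
  change ∃ m v, P.map (fun ω => L (X ω, Y ω)) = _
  rw [hL]
  exact ⟨0, _, ((hX.const_mul (L (1, 0))).add hW (hY.const_mul (L (0, 1))) (by fun_prop)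
    (by fun_prop) (by fun_prop) (by fun_prop)).map_eq hW (by fun_prop) (by fun_prop)⟩

end WienerIntegral

/-! ### The covariance of the mild solution at a fixed time -/

theorem measurable_greenKernel : Measurable fun p : ℝ × ℝ => greenKernel p.1 p.2 := by
  unfold greenKernel
  exact Measurable.ite (measurableSet_lt measurable_const measurable_fst) (by fun_prop)
    measurable_const

/-- The integrand of the mild solution at `(t, x)`. -/
noncomputable def mildKernel (t x : ℝ) : ℝ × ℝ → ℝ :=
  (Ioc (0 : ℝ) t ×ˢ (univ : Set ℝ)).indicator fun z : ℝ × ℝ => greenKernel (t - z.1) (x - z.2)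

theorem measurable_mildKernel (t x : ℝ) : Measurable (mildKernel t x) := by
  unfold mildKernel
  refine Measurable.indicator ?_ (measurableSet_Ioc.prod MeasurableSet.univ)
  exact measurable_greenKernel.comp
    ((measurable_const.sub measurable_fst).prodMk (measurable_const.sub measurable_snd))

/-- The heat kernel at time `2 s`. -/
noncomputable def heatKernelTwo (s z : ℝ) : ℝ := (2 * √Real.pi * √s)⁻¹ * Real.exp (-(z ^ 2 / (4 * s)))

theorem heatKernelTwo_nonneg (t z : ℝ) : 0 ≤ heatKernelTwo t z := by
  unfold heatKernelTwo; positivity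

/-- Completing the square at the midpoint of `x` and `x'`: the semigroup property of the heat
kernel. -/
theorem integral_greenKernel_mul {s : ℝ} (hs : 0 < s) (x x' : ℝ) :
    ∫ y, greenKernel s (x - y) * greenKernel s (x' - y) = heatKernelTwo s (x - x') := by
  have h : ∀ y, greenKernel s (x - y) * greenKernel s (x' - y) =
      ((2 * Real.pi * s)⁻¹ * Real.exp (-((x - x') ^ 2 / (4 * s)))) *
        Real.exp (-(1 / s) * (y - (x + x') / 2) ^ 2) := by
    intro y
    have h2 : (√(2 * Real.pi * s))⁻¹ * (√(2 * Real.pi * s))⁻¹ = (2 * Real.pi * s)⁻¹ := by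
      rw [← mul_inv, Real.mul_self_sqrt (by positivity)]
    simp only [greenKernel, hs, if_true, sq_abs]
    rw [mul_mul_mul_comm, h2, ← Real.exp_add, mul_assoc _ (Real.exp _), ← Real.exp_add]
    congr 2
    field_simp
    ring
  simp_rw [h]
  rw [integral_const_mul, integral_sub_right_eq_self (fun y => Real.exp (-(1 / s) * y ^ 2)),
    integral_gaussian, heatKernelTwo]
  have e : √(Real.pi / (1 / s)) = √Real.pi * √s := by
    rw [← Real.sqrt_mul Real.pi_pos.le]; congr 1; field_simp
  have h3 : 2 * Real.pi * s = 2 * (√Real.pi * √Real.pi) * (√s * √s) := by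
    rw [Real.mul_self_sqrt hs.le, Real.mul_self_sqrt Real.pi_pos.le]
  have := Real.sqrt_pos.2 hs
  have := Real.sqrt_pos.2 Real.pi_pos
  rw [e, h3]
  field_simp

theorem integral_mildKernel_mul {t : ℝ} (ht : 0 < t) (x x' : ℝ)
    (hx : MemLp (mildKernel t x) 2 volume) (hx' : MemLp (mildKernel t x') 2 volume) :
    ∫ z, mildKernel t x z * mildKernel t x' z = ∫ s in (0)..t, heatKernelTwo s (x - x') := by
  have hi := hx.integrable_mul hx'
  rw [Measure.volume_eq_prod] at hi ⊢
  rw [show (∫ z, mildKernel t x z * mildKernel t x' z ∂((volume : Measure ℝ).prod volume)) =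
    ∫ z, (mildKernel t x * mildKernel t x') z ∂((volume : Measure ℝ).prod volume) from rfl,
    integral_prod _ hi]
  have h : ∀ s, ∫ y, (mildKernel t x * mildKernel t x') (s, y) =
      (Ioc 0 t).indicator (fun s => if 0 < t - s then heatKernelTwo (t - s) (x - x') else 0) s := by
    intro s
    by_cases hs : s ∈ Ioc 0 t
    · simp only [Pi.mul_apply, mildKernel, indicator, mem_prod, hs, mem_univ, and_self, if_true]
      -- At `s = t` the Green kernel vanishes by convention, which is why the integrand carries an
      -- `if`.
      split_ifs with h'
      · exact integral_greenKernel_mul h' x x'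
      · simp [greenKernel, h']
    · simp [mildKernel, indicator, hs]
  simp_rw [h]
  rw [integral_indicator measurableSet_Ioc, ← intervalIntegral.integral_of_le ht.le,
    intervalIntegral.integral_comp_sub_left
      (fun s => if 0 < s then heatKernelTwo s (x - x') else 0)]
  rw [sub_self, sub_zero]
  refine intervalIntegral.integral_congr_ae (Eventually.of_forall fun s hs => ?_)
  rw [uIoc_of_le ht.le] at hs
  simp [hs.1]

/-! ### Closed form and Taylor estimates for the covariance -/

/-- The antiderivative `∫_0^x exp (-v ^ 2) dv`. -/
noncomputable def erfAux (x : ℝ) : ℝ := ∫ v in (0)..x, Real.exp (-(v ^ 2))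

theorem hasDerivAt_erfAux (x : ℝ) : HasDerivAt erfAux (Real.exp (-(x ^ 2))) x :=
  (by fun_prop : Continuous fun v : ℝ => Real.exp (-(v ^ 2))).integral_hasStrictDerivAt 0 x
    |>.hasDerivAt

theorem erfAux_zero : erfAux 0 = 0 := by simp [erfAux]

theorem erfAux_nonneg {x : ℝ} (hx : 0 ≤ x) : 0 ≤ erfAux x :=
  intervalIntegral.integral_nonneg hx fun _ _ => (Real.exp_pos _).le

theorem tendsto_erfAux : Tendsto erfAux atTop (𝓝 (√Real.pi / 2)) := by
  have h := integral_gaussian_Ioi 1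
  simp only [div_one, neg_mul, one_mul] at h
  rw [← h]
  refine intervalIntegral_tendsto_integral_Ioi 0 ?_ tendsto_id
  simpa using (integrable_exp_neg_mul_sq one_pos).integrableOn

/-- The covariance of the mild solution at time `t` between two points at distance `z ≥ 0`. -/
noncomputable def mildCov (t z : ℝ) : ℝ :=
  √t / √Real.pi * Real.exp (-(z ^ 2 / (4 * t))) -
    z * (1 / 2 - erfAux (z / (2 * √t)) / √Real.pi)

/-- Together with the vanishing limit at time `0`, this identifies `mildCov` with the time integral
of the heat kernel. -/
theorem hasDerivAt_mildCov_time {t : ℝ} (ht : 0 < t) (z : ℝ) :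
    HasDerivAt (fun s => mildCov s z) (heatKernelTwo t z) t := by
  have hs := Real.sqrt_pos.2 ht
  have hp := Real.sqrt_pos.2 Real.pi_pos
  have h1 : HasDerivAt (fun s : ℝ => √s) (1 / (2 * √t)) t := Real.hasDerivAt_sqrt ht.ne'
  have h2 : HasDerivAt (fun s : ℝ => Real.exp (-(z ^ 2 / (4 * s))))
      (Real.exp (-(z ^ 2 / (4 * t))) * (z ^ 2 / (4 * t ^ 2))) t := by
    have : HasDerivAt (fun s : ℝ => -(z ^ 2 / (4 * s))) (z ^ 2 / (4 * t ^ 2)) t := by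
      have := ((hasDerivAt_const t (z ^ 2)).div ((hasDerivAt_id t).const_mul 4)
        (by simpa using ht.ne')).neg
      convert! this using 1
      simp; field_simp
    exact this.exp
  have h3 : HasDerivAt (fun s : ℝ => z / (2 * √s)) (-(z / (4 * t * √t))) t := by
    have := (hasDerivAt_const t z).div (h1.const_mul 2) (by positivity)
    convert! this using 1
    have e : t = √t * √t := (Real.mul_self_sqrt ht.le).symm
    field_simp
    rw [Real.sq_sqrt ht.le]; ring
  have h4 := (hasDerivAt_erfAux (z / (2 * √t))).comp t h3
  have h5 := ((h1.div_const √Real.pi).mul h2).sub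
    (((hasDerivAt_const t (1 / 2 : ℝ)).sub (h4.div_const √Real.pi)).const_mul z)
  convert! h5 using 1
  have e2 : (z / (2 * √t)) ^ 2 = z ^ 2 / (4 * t) := by
    rw [div_pow, mul_pow, Real.sq_sqrt ht.le]; norm_num
  rw [e2, heatKernelTwo]
  have e : √t ^ 2 = t := Real.sq_sqrt ht.le
  generalize Real.exp (-(z ^ 2 / (4 * t))) = E
  generalize √t = r at *
  subst e
  field_simp
  ring

theorem hasDerivAt_mildCov {t : ℝ} (ht : 0 < t) (z : ℝ) :
    HasDerivAt (mildCov t) (erfAux (z / (2 * √t)) / √Real.pi - 1 / 2) z := by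
  have hs := Real.sqrt_pos.2 ht
  have hp := Real.sqrt_pos.2 Real.pi_pos
  have h2 : HasDerivAt (fun z : ℝ => Real.exp (-(z ^ 2 / (4 * t))))
      (Real.exp (-(z ^ 2 / (4 * t))) * (-(2 * z / (4 * t)))) z := by
    have : HasDerivAt (fun z : ℝ => -(z ^ 2 / (4 * t))) (-(2 * z / (4 * t))) z := by
      convert! ((hasDerivAt_pow 2 z).div_const (4 * t)).neg using 1
      simp
    exact this.exp
  have h4 := (hasDerivAt_erfAux (z / (2 * √t))).comp z ((hasDerivAt_id z).div_const (2 * √t))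
  have h5 := (h2.const_mul (√t / √Real.pi)).sub ((hasDerivAt_id z).mul
    ((h4.div_const √Real.pi).const_sub (1 / 2 : ℝ)))
  convert! h5 using 1
  have e2 : (z / (2 * √t)) ^ 2 = z ^ 2 / (4 * t) := by
    rw [div_pow, mul_pow, Real.sq_sqrt ht.le]; norm_num
  simp only [id, Function.comp, e2]
  have e : √t ^ 2 = t := Real.sq_sqrt ht.le
  generalize Real.exp (-(z ^ 2 / (4 * t))) = E
  generalize √t = r at *
  subst e
  field_simp
  ring

theorem tendsto_mildCov_zero {z : ℝ} (hz : 0 ≤ z) :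
    Tendsto (fun s => mildCov s z) (𝓝[>] 0) (𝓝 0) := by
  have hp := Real.sqrt_pos.2 Real.pi_pos
  have h1 : Tendsto (fun s : ℝ => √s) (𝓝[>] 0) (𝓝 0) := by
    simpa using (Real.continuous_sqrt.tendsto 0).mono_left nhdsWithin_le_nhds
  have hA : Tendsto (fun s => √s / √Real.pi * Real.exp (-(z ^ 2 / (4 * s)))) (𝓝[>] 0) (𝓝 0) := by
    refine squeeze_zero' (Eventually.of_forall fun s => by positivity)
      (g := fun s => √s / √Real.pi) ?_ (by simpa using h1.div_const √Real.pi)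
    filter_upwards [self_mem_nhdsWithin] with s hs
    have hs : 0 < s := hs
    refine mul_le_of_le_one_right (by positivity) (Real.exp_le_one_iff.2 ?_)
    simp only [Left.neg_nonpos_iff]; positivity
  have hB : Tendsto (fun s => z * (1 / 2 - erfAux (z / (2 * √s)) / √Real.pi)) (𝓝[>] 0) (𝓝 0) := by
    rcases hz.eq_or_lt with rfl | hz
    · simp
    have h1' : Tendsto (fun s : ℝ => 2 * √s) (𝓝[>] 0) (𝓝[>] 0) := by
      refine tendsto_nhdsWithin_iff.2 ⟨by simpa using h1.const_mul 2, ?_⟩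
      filter_upwards [self_mem_nhdsWithin] with s hs
      have hs : 0 < s := hs
      exact mem_Ioi.2 (by positivity)
    have h2 : Tendsto (fun s : ℝ => z / (2 * √s)) (𝓝[>] 0) atTop := by
      simp_rw [div_eq_mul_inv]
      exact (tendsto_inv_nhdsGT_zero.comp h1').const_mul_atTop hz
    -- The constant `1/2` in `mildCov` is the limit of `erfAux / √π`, so the bracket vanishes as the
    -- time tends to `0`.
    have h3 := (((tendsto_erfAux.comp h2).div_const √Real.pi).const_sub (1 / 2)).const_mul z
    convert! h3 using 2
    field_simp; ring
  simpa [mildCov] using hA.sub hB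

theorem intervalIntegrable_heatKernelTwo {t : ℝ} (ht : 0 < t) (z : ℝ) :
    IntervalIntegrable (fun s => heatKernelTwo s z) volume 0 t := by
  -- The singularity at `s = 0` is at worst `s^(-1/2)`, even when `z = 0`.
  have h : IntervalIntegrable (fun s : ℝ => s ^ (-(1 / 2) : ℝ)) volume 0 t :=
    intervalIntegral.intervalIntegrable_rpow' (by norm_num)
  refine (h.const_mul (2 * √Real.pi)⁻¹).mono_fun ?_ ?_
  · unfold heatKernelTwo
    exact (by fun_prop : Measurable _).aestronglyMeasurable
  · refine (ae_restrict_iff' measurableSet_uIoc).2 (Eventually.of_forall fun s hs => ?_)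
    rw [uIoc_of_le ht.le] at hs
    have hs0 := hs.1
    beta_reduce
    rw [Real.norm_of_nonneg (heatKernelTwo_nonneg s z), Real.norm_of_nonneg (by positivity),
      heatKernelTwo,
      Real.rpow_neg hs0.le, ← Real.sqrt_eq_rpow, mul_inv]
    refine mul_le_of_le_one_right (by positivity) (Real.exp_le_one_iff.2 ?_)
    simp only [Left.neg_nonpos_iff]; positivity

theorem integral_heatKernelTwo {t : ℝ} (ht : 0 < t) (z : ℝ) :
    ∫ s in (0)..t, heatKernelTwo s z = mildCov t |z| := by
  have : ∀ s, heatKernelTwo s z = heatKernelTwo s |z| := by simp [heatKernelTwo]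
  simp_rw [this]
  rw [intervalIntegral.integral_eq_sub_of_hasDerivAt_of_tendsto ht
    (fun s hs => hasDerivAt_mildCov_time hs.1 |z|) (intervalIntegrable_heatKernelTwo ht _)
    (tendsto_mildCov_zero (abs_nonneg z))
    ((hasDerivAt_mildCov_time ht |z|).continuousAt.tendsto.mono_left nhdsWithin_le_nhds), sub_zero]

/-- The derivative of `mildCov t`. -/
noncomputable def mildCovDeriv (t z : ℝ) : ℝ := erfAux (z / (2 * √t)) / √Real.pi - 1 / 2

theorem hasDerivAt_mildCovDeriv {t : ℝ} (ht : 0 < t) (z : ℝ) :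
    HasDerivAt (mildCovDeriv t) (heatKernelTwo t z) z := by
  have hs := Real.sqrt_pos.2 ht
  have hp := Real.sqrt_pos.2 Real.pi_pos
  have h4 := (hasDerivAt_erfAux (z / (2 * √t))).comp z ((hasDerivAt_id z).div_const (2 * √t))
  have h5 := (h4.div_const √Real.pi).sub_const (1 / 2)
  convert! h5 using 1
  have e2 : (z / (2 * √t)) ^ 2 = z ^ 2 / (4 * t) := by
    rw [div_pow, mul_pow, Real.sq_sqrt ht.le]; norm_num
  simp only [e2, heatKernelTwo]
  field_simp

theorem heatKernelTwo_le {t : ℝ} (ht : 0 < t) (z : ℝ) :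
    heatKernelTwo t z ≤ (2 * √Real.pi * √t)⁻¹ := by
  refine mul_le_of_le_one_right (by positivity) (Real.exp_le_one_iff.2 ?_)
  simp only [Left.neg_nonpos_iff]; positivity

theorem mildCovDeriv_zero (t : ℝ) : mildCovDeriv t 0 = -(1 / 2) := by
  simp [mildCovDeriv, erfAux_zero]

theorem abs_mildCovDeriv_sub_le {t : ℝ} (ht : 0 < t) (y z : ℝ) :
    |mildCovDeriv t z - mildCovDeriv t y| ≤ (2 * √Real.pi * √t)⁻¹ * |z - y| := by
  refine convex_univ.norm_image_sub_le_of_norm_hasDerivWithin_le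
    (fun x _ => (hasDerivAt_mildCovDeriv ht x).hasDerivWithinAt) (fun x _ => ?_) trivial trivial
  rw [Real.norm_of_nonneg (heatKernelTwo_nonneg t x)]
  exact heatKernelTwo_le ht x

/-- The second-order Taylor estimate for `mildCov t`. -/
theorem abs_mildCov_taylor_le {t : ℝ} (ht : 0 < t) (z h : ℝ) :
    |mildCov t (z + h) - mildCov t z - mildCovDeriv t z * h| ≤
      (2 * √Real.pi * √t)⁻¹ * h ^ 2 := by
  have hd : ∀ x ∈ uIcc 0 h, HasDerivWithinAt
      (fun x => mildCov t (z + x) - mildCovDeriv t z * x)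
      (mildCovDeriv t (z + x) - mildCovDeriv t z) (uIcc 0 h) x := fun x _ => by
    have h1 := (hasDerivAt_mildCov ht (z + x)).comp_const_add z x
    exact (h1.sub (by simpa using (hasDerivAt_id x).const_mul (mildCovDeriv t z))).hasDerivWithinAt
  have := (convex_uIcc 0 h).norm_image_sub_le_of_norm_hasDerivWithin_le hd
    (C := (2 * √Real.pi * √t)⁻¹ * |h|) (fun x hx => ?_) left_mem_uIcc right_mem_uIcc
  · rw [Real.norm_eq_abs, Real.norm_eq_abs, sub_zero, mul_assoc, abs_mul_abs_self, ← sq] at this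
    convert! this using 2
    simp; ring
  · refine (abs_mildCovDeriv_sub_le ht z (z + x)).trans ?_
    refine mul_le_mul_of_nonneg_left ?_ (by positivity)
    have := abs_sub_left_of_mem_uIcc hx
    simpa using this

/-- The first-order terms of the Taylor expansions at `h` and `-h` cancel. -/
theorem abs_mildCov_second_difference_le {t : ℝ} (ht : 0 < t) (z h : ℝ) :
    |2 * mildCov t z - mildCov t (z + h) - mildCov t (z - h)| ≤
      2 * (2 * √Real.pi * √t)⁻¹ * h ^ 2 := by
  have h1 := abs_mildCov_taylor_le ht z h
  have h2 := abs_mildCov_taylor_le ht z (-h)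
  rw [neg_sq, ← sub_eq_add_neg] at h2
  rw [abs_le] at *
  constructor <;> linarith [h1.1, h1.2, h2.1, h2.2]

/-- The variance of the increments of the mild solution over a distance `h`. -/
noncomputable def mildVar (t h : ℝ) : ℝ := 2 * (mildCov t 0 - mildCov t h)

/-- The slope `-1/2` of `mildCov t` at `0` gives the leading term `h`. -/
theorem mildVar_ge {t : ℝ} (ht : 0 < t) (h : ℝ) :
    h - 2 * (2 * √Real.pi * √t)⁻¹ * h ^ 2 ≤ mildVar t h := by
  have h1 := abs_mildCov_taylor_le ht 0 h
  rw [mildCovDeriv_zero, zero_add, abs_le] at h1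
  unfold mildVar
  linarith [h1.2]

/-- On `[0, h]` the slope of `mildCov t` is at least `-1/2`, because `erfAux` is nonnegative there.
-/
theorem mildVar_le {t : ℝ} (ht : 0 < t) {h : ℝ} (hh : 0 ≤ h) : mildVar t h ≤ h := by
  have hd : ∀ x ∈ Icc 0 h, HasDerivWithinAt (fun x => mildCov t x + x / 2)
      (mildCovDeriv t x + 1 / 2) (Icc 0 h) x := fun x _ =>
    ((hasDerivAt_mildCov ht x).add ((hasDerivAt_id x).div_const 2)).hasDerivWithinAt
  have hm : MonotoneOn (fun x => mildCov t x + x / 2) (Icc 0 h) := by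
    refine monotoneOn_of_hasDerivWithinAt_nonneg (convex_Icc 0 h)
      (fun x hx => (hd x hx).continuousWithinAt)
      (fun x hx => (hd x (interior_subset hx)).mono interior_subset) fun x hx => ?_
    have hx0 : 0 ≤ x := (interior_subset hx).1
    have := erfAux_nonneg (x := x / (2 * √t)) (by positivity)
    unfold mildCovDeriv
    have h3 : 0 ≤ erfAux (x / (2 * √t)) / √Real.pi := by positivity
    linarith
  have := hm (left_mem_Icc.2 hh) (right_mem_Icc.2 hh) hh
  unfold mildVar
  simp only at this
  linarith

/-! ### Deterministic estimates in Besov–Orlicz spaces -/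

/-- Gaussian integrability controls all `L^p` norms, with the rate `√p`. -/
theorem eLpNorm_le_of_lintegral_exp_sq_le {α : Type*} [MeasurableSpace α] {μ : Measure α}
    {f : α → ℝ} {a : ℝ} (ha : 0 < a) {M : ℝ≥0∞} (hM : 1 ≤ M)
    (h : ∫⁻ x, ENNReal.ofReal (Real.exp (a * f x ^ 2)) ∂μ ≤ M) {p : ℝ} (hp : 1 ≤ p) :
    eLpNorm f (ENNReal.ofReal p) μ ≤ ENNReal.ofReal (√p) * (ENNReal.ofReal (√(2 * a))⁻¹ * M) := by
  have hp0 : 0 < p := by linarith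
  have hpt : ∀ x, ‖f x‖ₑ ^ p ≤ ENNReal.ofReal ((p / (2 * a)) ^ (p / 2)) *
      ENNReal.ofReal (Real.exp (a * f x ^ 2)) := by
    intro x
    rw [← ENNReal.ofReal_mul (by positivity), Real.enorm_eq_ofReal_abs,
      ENNReal.ofReal_rpow_of_nonneg (abs_nonneg _) hp0.le]
    refine ENNReal.ofReal_le_ofReal ?_
    have h1 : |f x| ^ p = (f x ^ 2) ^ (p / 2) := by
      rw [← sq_abs, ← Real.rpow_natCast, ← Real.rpow_mul (abs_nonneg _)]
      congr 1; push_cast; ring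
    -- This is `y ≤ exp y` with `y = 2 a f² / p`, chosen so that raising to the power `p / 2` gives
    -- back `exp (a f²)` for every `p`.
    have h2 : f x ^ 2 ≤ p / (2 * a) * Real.exp (2 * a * f x ^ 2 / p) := by
      have := Real.add_one_le_exp (2 * a * f x ^ 2 / p)
      calc f x ^ 2 = p / (2 * a) * (2 * a * f x ^ 2 / p) := by field_simp
        _ ≤ _ := by gcongr; linarith
    calc |f x| ^ p ≤ (p / (2 * a) * Real.exp (2 * a * f x ^ 2 / p)) ^ (p / 2) := by
          rw [h1]; exact Real.rpow_le_rpow (sq_nonneg _) h2 (by positivity)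
      _ = _ := by
          rw [Real.mul_rpow (by positivity) (by positivity), ← Real.exp_mul]
          congr 2; field_simp
  have hint : ∫⁻ x, ‖f x‖ₑ ^ p ∂μ ≤ ENNReal.ofReal ((p / (2 * a)) ^ (p / 2)) * M := by
    refine (lintegral_mono hpt).trans ?_
    rw [lintegral_const_mul' _ _ ENNReal.ofReal_ne_top]
    gcongr
  rw [eLpNorm_eq_lintegral_rpow_enorm_toReal (by simpa using hp0) ENNReal.ofReal_ne_top,
    ENNReal.toReal_ofReal hp0.le]
  calc (∫⁻ x, ‖f x‖ₑ ^ p ∂μ) ^ (1 / p)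
      ≤ (ENNReal.ofReal ((p / (2 * a)) ^ (p / 2)) * M) ^ (1 / p) := by gcongr
    _ = ENNReal.ofReal (√p * (√(2 * a))⁻¹) * M ^ (1 / p) := by
        rw [ENNReal.mul_rpow_of_nonneg _ _ (by positivity),
          ENNReal.ofReal_rpow_of_nonneg (by positivity) (by positivity),
          ← Real.rpow_mul (by positivity), ← div_eq_mul_inv, ← Real.sqrt_div hp0.le,
          Real.sqrt_eq_rpow]
        congr 3
        field_simp
    -- Here `1 ≤ M` makes the bound uniform in `p`.
    _ ≤ ENNReal.ofReal (√p * (√(2 * a))⁻¹) * M := by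
        gcongr
        calc M ^ (1 / p) ≤ M ^ (1 : ℝ) :=
              ENNReal.rpow_le_rpow_of_exponent_le hM ((div_le_one hp0).2 hp)
          _ = M := ENNReal.rpow_one M
    _ = _ := by rw [ENNReal.ofReal_mul (by positivity), mul_assoc]

/-- A subadditive function that is small on the scales `2 ^ (-k)` is small everywhere. -/
theorem le_of_subadditive_of_dyadic {N : ℝ → ℝ≥0∞} {B : ℝ≥0∞}
    (hadd : ∀ s r, 0 ≤ s → 0 ≤ r → N (s + r) ≤ N s + N r)
    (h0 : Tendsto N (𝓝 0) (𝓝 0))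
    (hB : ∀ k : ℕ, 1 ≤ k → N ((1 / 2) ^ k) ≤ B * ENNReal.ofReal (√(1 / 2) ^ k))
    {s : ℝ} (hs : 0 < s) (hs1 : s ≤ 1) : N s ≤ 4 * B * ENNReal.ofReal (√s) := by
  obtain ⟨k, hk1, hk2⟩ := exists_nat_pow_near_of_lt_one hs hs1 (y := 1 / 2) (by norm_num)
    (by norm_num)
  set q : ℝ := √(1 / 2) with hq
  have hq0 : 0 ≤ q := Real.sqrt_nonneg _
  -- A crude bound giving the geometric sum at most `1 / (1 - 3/4) = 4`, the constant of the
  -- conclusion.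
  have hq1 : q ≤ 3 / 4 := Real.sqrt_le_iff.2 ⟨by norm_num, by norm_num⟩
  -- Greedy binary expansion of `s`: at each scale the dyadic step is removed if it fits, and `r` is
  -- the remainder. Only exponents at least `k + 1 ≥ 1` occur.
  have hgreedy : ∀ n : ℕ, ∃ r, 0 ≤ r ∧ r ≤ (1 / 2) ^ (k + n) ∧
      N s ≤ N r + B * ENNReal.ofReal (∑ i ∈ Finset.range n, q ^ (k + 1 + i)) := by
    intro n
    induction n with
    | zero => exact ⟨s, hs.le, by simpa using hk2, by simp⟩
    | succ n ih =>
      obtain ⟨r, hr0, hr1, hr⟩ := ih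
      rw [Finset.sum_range_succ, ENNReal.ofReal_add (Finset.sum_nonneg fun _ _ => by positivity)
        (by positivity), mul_add]
      by_cases hc : r ≤ (1 / 2) ^ (k + (n + 1))
      · exact ⟨r, hr0, hc, hr.trans (by gcongr; exact le_self_add)⟩
      · rw [not_le] at hc
        refine ⟨r - (1 / 2) ^ (k + (n + 1)), by linarith, ?_, ?_⟩
        · have : (1 / 2 : ℝ) ^ (k + n) = 2 * (1 / 2) ^ (k + (n + 1)) := by
            rw [← add_assoc, pow_succ]; ring
          linarith
        · have h1 := hadd (r - (1 / 2) ^ (k + (n + 1))) ((1 / 2) ^ (k + (n + 1))) (by linarith)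
            (by positivity)
          rw [sub_add_cancel] at h1
          have h2 := hB (k + (n + 1)) (by omega)
          rw [show k + (n + 1) = k + 1 + n by ring] at h1 h2 ⊢
          calc N s ≤ _ := hr
            _ ≤ (N (r - (1 / 2) ^ (k + 1 + n)) + B * ENNReal.ofReal (q ^ (k + 1 + n))) + _ := by
              gcongr; exact h1.trans (by gcongr)
            _ = _ := by rw [add_assoc, add_comm (B * ENNReal.ofReal (q ^ (k + 1 + n)))]
  choose r hr0 hr1 hr using hgreedy
  have hrt : Tendsto r atTop (𝓝 0) := by
    refine tendsto_of_tendsto_of_tendsto_of_le_of_le tendsto_const_nhds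
      (h := fun n => (1 / 2) ^ n) (tendsto_pow_atTop_nhds_zero_of_lt_one (by norm_num)
      (by norm_num)) hr0 fun n => (hr1 n).trans ?_
    exact pow_le_pow_of_le_one (by norm_num) (by norm_num) (by omega)
  have hsum : ∀ n, ∑ i ∈ Finset.range n, q ^ (k + 1 + i) ≤ 4 * √s := by
    intro n
    have h1 : q ^ (k + 1) ≤ √s := by
      refine Real.le_sqrt_of_sq_le ?_
      rw [← pow_mul, mul_comm, pow_mul, hq, Real.sq_sqrt (by norm_num)]
      exact hk1.le
    have h2 : ∑ i ∈ Finset.range n, q ^ i ≤ 4 := by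
      have := geom_sum_mul_neg q n
      have h3 : 0 ≤ q ^ n := by positivity
      have h4 : 0 ≤ ∑ i ∈ Finset.range n, q ^ i := Finset.sum_nonneg fun _ _ => by positivity
      nlinarith
    simp_rw [pow_add q (k + 1), ← Finset.mul_sum]
    have h4 : 0 ≤ ∑ i ∈ Finset.range n, q ^ i := Finset.sum_nonneg fun _ _ => by positivity
    nlinarith [Real.sqrt_nonneg s, pow_nonneg hq0 (k + 1)]
  -- The remainders tend to `0`, where `N` vanishes in the limit, so only the geometric sum
  -- survives.
  have hlim : Tendsto (fun n => N (r n) + 4 * B * ENNReal.ofReal (√s)) atTop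
      (𝓝 (0 + 4 * B * ENNReal.ofReal (√s))) := (h0.comp hrt).add tendsto_const_nhds
  rw [zero_add] at hlim
  refine ge_of_tendsto' hlim fun n => (hr n).trans (add_le_add_right ?_ _)
  calc B * ENNReal.ofReal (∑ i ∈ Finset.range n, q ^ (k + 1 + i))
      ≤ B * ENNReal.ofReal (4 * √s) := by gcongr; exact hsum n
    _ = _ := by rw [ENNReal.ofReal_mul (by norm_num)]; simp; ring

/-! ### Shift domains and increment norms -/

theorem measurableSet_shiftDomain {I : Set ℝ} (hI : MeasurableSet I) (s : ℝ) :
    MeasurableSet (shiftDomain I s) :=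
  hI.inter (hI.preimage (measurable_add_const s))

theorem shiftDomain_Icc {s : ℝ} (hs : 0 ≤ s) : shiftDomain (Icc 0 1) s = Icc 0 (1 - s) := by
  ext x
  simp only [shiftDomain, mem_ofPred_eq, mem_Icc]
  constructor
  · rintro ⟨⟨h1, h2⟩, h3, h4⟩; exact ⟨h1, by linarith⟩
  · rintro ⟨h1, h2⟩; exact ⟨⟨h1, by linarith⟩, by linarith, by linarith⟩

/-- The `L^p` norm of the increments of `f` over a distance `s`. -/
noncomputable def incNorm (f : ℝ → ℝ) (p : ℝ≥0∞) (s : ℝ) : ℝ≥0∞ :=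
  eLpNorm (fun x => f (x + s) - f x) p (volume.restrict (shiftDomain (Icc 0 1) s))

/-- Translation by `s` carries the domain of one shift onto that of the other, so only nonnegative
shifts need estimates. -/
theorem incNorm_neg {f : ℝ → ℝ} (hf : Measurable f) (p : ℝ≥0∞) (s : ℝ) :
    incNorm f p (-s) = incNorm f p s := by
  have hmp := (measurePreserving_add_right volume s).restrict_preimage
    (measurableSet_shiftDomain measurableSet_Icc (-s) : MeasurableSet (shiftDomain (Icc 0 1) (-s)))
  have hpre : (fun x => x + s) ⁻¹' shiftDomain (Icc 0 1) (-s) = shiftDomain (Icc 0 1) s := by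
    ext x; simp [shiftDomain, and_comm]
  rw [hpre] at hmp
  have hm : Measurable fun x => f (x + -s) - f x := by fun_prop
  rw [incNorm, ← eLpNorm_comp_measurePreserving hm.aestronglyMeasurable hmp, incNorm,
    ← eLpNorm_neg]
  congr 1
  ext x; simp

/-- Minkowski's inequality for a shift made in two steps. The translated second increment stays on
an admissible domain because `I` is an interval. -/
theorem incNorm_add_le {f : ℝ → ℝ} (hf : Measurable f) {p : ℝ≥0∞} (hp : 1 ≤ p) {s r : ℝ}
    (hs : 0 ≤ s) (hr : 0 ≤ r) : incNorm f p (s + r) ≤ incNorm f p s + incNorm f p r := by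
  have h1 : Measurable fun x => f (x + s) - f x := by fun_prop
  have h2 : Measurable fun x => f (x + r) - f x := by fun_prop
  have h2' : Measurable fun x => f (x + s + r) - f (x + s) := by fun_prop
  have hmp := (measurePreserving_add_right volume s).restrict_preimage
    (measurableSet_shiftDomain measurableSet_Icc r : MeasurableSet (shiftDomain (Icc 0 1) r))
  calc incNorm f p (s + r)
      = eLpNorm ((fun x => f (x + s) - f x) + fun x => f (x + s + r) - f (x + s)) p
          (volume.restrict (shiftDomain (Icc 0 1) (s + r))) := by
        unfold incNorm; congr 1; ext x; simp [add_assoc]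
    _ ≤ _ := eLpNorm_add_le h1.aestronglyMeasurable h2'.aestronglyMeasurable hp
    _ ≤ _ := by
        gcongr
        · refine eLpNorm_mono_measure _ (Measure.restrict_mono_set _ ?_)
          rw [shiftDomain_Icc hs, shiftDomain_Icc (add_nonneg hs hr)]
          exact Icc_subset_Icc_right (by linarith)
        · rw [incNorm, ← eLpNorm_comp_measurePreserving h2.aestronglyMeasurable hmp]
          refine eLpNorm_mono_measure _ (Measure.restrict_mono_set _ ?_)
          rw [shiftDomain_Icc hr, shiftDomain_Icc (add_nonneg hs hr)]
          intro x hx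
          exact ⟨by linarith [hx.1], by linarith [hx.2]⟩

/-- Continuity of translations in `L^p`, `p < ∞`, applied to the extension of `f` by zero, which
agrees with `f` at both points when `x` is in the shift domain. -/
theorem tendsto_incNorm_zero {f : ℝ → ℝ} {p : ℝ≥0∞} (hp : 1 ≤ p) (hp' : p ≠ ∞)
    (hf : MemLp f p (volume.restrict (Icc 0 1))) : Tendsto (incNorm f p) (𝓝 0) (𝓝 0) := by
  have : Fact (1 ≤ p) := ⟨hp⟩
  have : Fact (p ≠ ∞) := ⟨hp'⟩
  have hF : MemLp ((Icc (0 : ℝ) 1).indicator f) p volume :=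
    (memLp_indicator_iff_restrict measurableSet_Icc).2 hf
  set F := hF.toLp with hFdef
  have hc : Continuous fun s : ℝ => DomAddAct.mk s +ᵥ F :=
    DomAddAct.continuous_mk.vadd continuous_const
  have ht : Tendsto (fun s : ℝ => edist (DomAddAct.mk s +ᵥ F) F) (𝓝 0) (𝓝 0) := by
    have := (hc.edist (continuous_const (y := F))).tendsto 0
    simpa using this
  refine tendsto_of_tendsto_of_tendsto_of_le_of_le tendsto_const_nhds ht (fun _ => zero_le)
    fun s => ?_
  rw [Lp.edist_def, incNorm]
  refine (le_of_eq ?_).trans (eLpNorm_mono_measure _ (Measure.restrict_le_self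
    (s := shiftDomain (Icc 0 1) s)))
  refine eLpNorm_congr_ae ?_
  have e1 := DomAddAct.mk_vadd_toLp s hF
  have e2 : (DomAddAct.mk s +ᵥ F : Lp ℝ p volume) =ᵐ[volume]
      fun x => (Icc (0 : ℝ) 1).indicator f (s +ᵥ x) := by
    rw [hFdef, e1]; exact MemLp.coeFn_toLp _
  refine (ae_restrict_iff' (measurableSet_shiftDomain measurableSet_Icc s)).2 ?_
  filter_upwards [e2, hF.coeFn_toLp] with x h2 h3 hx
  simp only [Pi.sub_apply]
  rw [h2, hFdef, h3, indicator_of_mem hx.1, indicator_of_mem (by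
    simpa [add_comm s x] using hx.2), vadd_eq_add, add_comm s x]

/-! ### Invariance under almost everywhere modification -/

theorem lpModulus_congr {f g : ℝ → ℝ} {I : Set ℝ} (hI : MeasurableSet I)
    (h : f =ᵐ[volume.restrict I] g) (p t : ℝ) : lpModulus p f I t = lpModulus p g I t := by
  unfold lpModulus
  refine iSup_congr fun s => iSup_congr fun _ => eLpNorm_congr_ae ?_
  have h' := (ae_restrict_iff' hI).1 h
  have hs : ∀ᵐ x : ℝ, x + s ∈ I → f (x + s) = g (x + s) :=
    (measurePreserving_add_right volume s).quasiMeasurePreserving.ae h'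
  refine (ae_restrict_iff' (measurableSet_shiftDomain hI s)).2 ?_
  filter_upwards [h', hs] with x h1 h2 hx
  rw [h1 hx.1, h2 hx.2]

theorem orliczModulus_congr {f g : ℝ → ℝ} {I : Set ℝ} (hI : MeasurableSet I)
    (h : f =ᵐ[volume.restrict I] g) (t : ℝ) : orliczModulus f I t = orliczModulus g I t := by
  unfold orliczModulus
  simp_rw [lpModulus_congr hI h]

theorem orliczNorm_congr {f g : ℝ → ℝ} {I : Set ℝ}
    (h : f =ᵐ[volume.restrict I] g) : orliczNorm f I = orliczNorm g I := by
  unfold orliczNorm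
  simp_rw [eLpNorm_congr_ae h]

theorem memOrlicz_congr {f g : ℝ → ℝ} {I : Set ℝ}
    (h : f =ᵐ[volume.restrict I] g) : MemOrlicz f I ↔ MemOrlicz g I := by
  have : orliczNormStar f I = orliczNormStar g I := by
    unfold orliczNormStar
    refine iInf_congr fun l => iInf_congr fun _ => ?_
    congr 2
    refine lintegral_congr_ae ?_
    filter_upwards [h] with x hx
    rw [hx]
  rw [MemOrlicz, MemOrlicz, aemeasurable_congr h, this]

theorem memBesovOrlicz_congr {f g : ℝ → ℝ} {I : Set ℝ} (hI : MeasurableSet I)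
    (h : f =ᵐ[volume.restrict I] g) (α : ℝ) :
    MemBesovOrlicz α f I ↔ MemBesovOrlicz α g I := by
  simp_rw [MemBesovOrlicz, besovOrliczNorm, memOrlicz_congr h, orliczNorm_congr h,
    orliczModulus_congr hI h]

theorem memBesovOrliczZero_congr {f g : ℝ → ℝ} {I : Set ℝ} (hI : MeasurableSet I)
    (h : f =ᵐ[volume.restrict I] g) (α : ℝ) :
    MemBesovOrliczZero α f I ↔ MemBesovOrliczZero α g I := by
  simp_rw [MemBesovOrliczZero, memOrlicz_congr h, orliczModulus_congr hI h]

theorem orliczNormStar_lt_top {f : ℝ → ℝ} {I : Set ℝ} {a : ℝ} (ha : 0 < a)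
    (h : ∫⁻ x in I, ENNReal.ofReal (Real.exp (a * f x ^ 2)) ≠ ∞) : orliczNormStar f I < ∞ := by
  refine (iInf₂_le (√a) (Real.sqrt_pos.2 ha)).trans_lt ?_
  refine ENNReal.mul_lt_top ENNReal.ofReal_lt_top
    (ENNReal.add_lt_top.2 ⟨ENNReal.one_lt_top, lt_of_le_of_lt (lintegral_mono fun x => ?_) h.lt_top⟩)
  refine ENNReal.ofReal_le_ofReal ?_
  rw [youngN, mul_pow, Real.sq_sqrt ha.le]
  linarith

/-- Gaussian integrability of a function and of its dyadic increments, at the scale `2 ^ (-k / 2)`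
and uniformly in `k`, gives membership in the Besov–Orlicz space of index `1 / 2`. -/
theorem memBesovOrlicz_of_lintegral_exp_le {f : ℝ → ℝ} (hf : Measurable f) {a : ℝ} (ha : 0 < a)
    {M : ℝ≥0∞} (hM : M ≠ ∞)
    (h1 : ∫⁻ x in Icc 0 1, ENNReal.ofReal (Real.exp (a * f x ^ 2)) ≤ M)
    (h2 : ∀ k : ℕ, 1 ≤ k → ∫⁻ x in Icc 0 (1 - (1 / 2) ^ k),
      ENNReal.ofReal (Real.exp (a * 2 ^ k * (f (x + (1 / 2) ^ k) - f x) ^ 2)) ≤ M) :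
    MemBesovOrlicz (1 / 2) f (Icc 0 1) := by
  set C : ℝ≥0∞ := ENNReal.ofReal (√(2 * a))⁻¹ * (1 + M) with hC
  have hCtop : C ≠ ∞ := ENNReal.mul_ne_top ENNReal.ofReal_ne_top (by simp [hM])
  have hnorm : ∀ p : ℝ, 1 ≤ p → eLpNorm f (ENNReal.ofReal p) (volume.restrict (Icc 0 1)) ≤
      ENNReal.ofReal (√p) * C := fun p hp =>
    eLpNorm_le_of_lintegral_exp_sq_le ha le_self_add (h1.trans le_add_self) hp
  have hsq : ∀ p : ℝ, 1 ≤ p → ENNReal.ofReal (√p) ≠ 0 := fun p hp => by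
    simpa using by linarith
  have hinc : ∀ p : ℝ, 1 ≤ p → ∀ s : ℝ, 0 < s → s ≤ 1 →
      incNorm f (ENNReal.ofReal p) s ≤ 4 * (ENNReal.ofReal (√p) * C) * ENNReal.ofReal (√s) := by
    intro p hp s hs hs1
    have hp' : 1 ≤ ENNReal.ofReal p := by simpa using hp
    refine le_of_subadditive_of_dyadic (fun s r hs hr => incNorm_add_le hf hp' hs hr)
      (tendsto_incNorm_zero hp' ENNReal.ofReal_ne_top ⟨hf.aestronglyMeasurable,
        (hnorm p hp).trans_lt (ENNReal.mul_lt_top ENNReal.ofReal_lt_top hCtop.lt_top)⟩)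
      (fun k hk => ?_) hs hs1
    have h3 := eLpNorm_le_of_lintegral_exp_sq_le (a := a * 2 ^ k) (by positivity)
      (le_self_add (a := 1) (b := M)) ((h2 k hk).trans le_add_self) hp
    rw [incNorm, shiftDomain_Icc (by positivity)]
    refine h3.trans (le_of_eq ?_)
    -- The factor `2^k` in the exponent becomes the Hölder factor `2^(-k/2)`.
    have e : (√(2 * (a * 2 ^ k)))⁻¹ = (√(2 * a))⁻¹ * √(1 / 2) ^ k := by
      rw [← mul_assoc, Real.sqrt_mul (by positivity), mul_inv]
      congr 1
      rw [← Real.sqrt_inv, ← inv_pow, one_div]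
      refine (Real.sqrt_eq_iff_mul_self_eq (by positivity) (by positivity)).2 ?_
      rw [← mul_pow, Real.mul_self_sqrt (by positivity)]
    rw [e, ENNReal.ofReal_mul (by positivity), hC]
    ring
  refine ⟨⟨hf.aemeasurable, orliczNormStar_lt_top ha (ne_top_of_le_ne_top hM h1)⟩,
    ENNReal.add_lt_top.2 ⟨?_, ?_⟩⟩
  · refine (iSup₂_le fun p hp => ?_).trans_lt hCtop.lt_top
    refine ENNReal.div_le_of_le_mul ?_
    rw [mul_comm]
    exact hnorm p hp
  · refine (iSup₂_le (a := 4 * C) fun t ht => ?_).trans_lt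
      (ENNReal.mul_lt_top (by simp) hCtop.lt_top)
    refine ENNReal.div_le_of_le_mul (iSup₂_le fun p hp => ENNReal.div_le_of_le_mul
      (iSup₂_le fun s hs => ?_))
    have hle : incNorm f (ENNReal.ofReal p) |s| ≤
        4 * (ENNReal.ofReal (√p) * C) * ENNReal.ofReal (√t) := by
      rcases eq_or_ne s 0 with rfl | hs0
      · simp [incNorm]
      · refine (hinc p hp _ (abs_pos.2 hs0) (hs.trans ht.2)).trans ?_
        gcongr
    rw [← Real.sqrt_eq_rpow]
    calc _ = incNorm f (ENNReal.ofReal p) |s| := by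
          rcases abs_choice s with h | h <;> rw [h]
          · rfl
          · rw [incNorm_neg hf]; rfl
      _ ≤ _ := hle
      _ = _ := by ring

/-- If the quadratic means of the dyadic increments do not decay faster than `2 ^ (-k / 2)`, the
function is not in the little Besov–Orlicz space of index `1 / 2`. -/
theorem not_memBesovOrliczZero_of_le_lintegral_sq {f : ℝ → ℝ} {δ : ℝ} (hδ : 0 < δ)
    (h : ∀ᶠ k : ℕ in atTop, ENNReal.ofReal (δ * (1 / 2) ^ k) ≤
      ∫⁻ x in Icc 0 (1 - (1 / 2) ^ k), ENNReal.ofReal ((f (x + (1 / 2) ^ k) - f x) ^ 2)) :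
    ¬ MemBesovOrliczZero (1 / 2) f (Icc 0 1) := by
  rintro ⟨-, ht⟩
  have hk : Tendsto (fun k : ℕ => ((1 / 2 : ℝ)) ^ k) atTop (𝓝[>] 0) :=
    tendsto_nhdsWithin_iff.2 ⟨tendsto_pow_atTop_nhds_zero_of_lt_one (by norm_num) (by norm_num),
      Eventually.of_forall fun k => mem_Ioi.2 (by positivity)⟩
  have hc : (0 : ℝ≥0∞) < ENNReal.ofReal (√δ / √2) := by
    rw [ENNReal.ofReal_pos]; positivity
  have hev := (ht.comp hk).eventually_lt_const hc
  obtain ⟨k, hk1, hk2⟩ := (h.and hev).exists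
  refine hk2.not_ge ?_
  simp only [Function.comp]
  have hh : (0 : ℝ) < (1 / 2) ^ k := by positivity
  set s : ℝ := (1 / 2) ^ k with hs
  rw [← Real.sqrt_eq_rpow, ENNReal.le_div_iff_mul_le (Or.inl (by simpa using hh))
    (Or.inl ENNReal.ofReal_ne_top), ← ENNReal.ofReal_mul (by positivity)]
  -- Only `p = 2` and the largest shift `s` are kept from the suprema; the `√2` in the constant is
  -- the normalisation `√p`.
  have h1 : eLpNorm (fun x => f (x + s) - f x) 2 (volume.restrict (Icc 0 (1 - s))) ≤
      lpModulus 2 f (Icc 0 1) s := by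
    have := le_iSup₂_of_le (f := fun (r : ℝ) (_ : |r| ≤ s) => eLpNorm (fun x => f (x + r) - f x)
      (ENNReal.ofReal 2) (volume.restrict (shiftDomain (Icc 0 1) r))) s (abs_of_pos hh).le le_rfl
    rw [shiftDomain_Icc hh.le] at this
    simpa [lpModulus] using this
  have h2 : lpModulus 2 f (Icc 0 1) s / ENNReal.ofReal (√2) ≤ orliczModulus f (Icc 0 1) s :=
    le_iSup₂_of_le (f := fun (p : ℝ) (_ : 1 ≤ p) =>
      lpModulus p f (Icc 0 1) s / ENNReal.ofReal (√p)) 2 one_le_two le_rfl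
  refine le_trans ?_ h2
  rw [ENNReal.le_div_iff_mul_le (Or.inl (by simp)) (Or.inl ENNReal.ofReal_ne_top),
    ← ENNReal.ofReal_mul (by positivity)]
  refine le_trans ?_ h1
  rw [eLpNorm_eq_lintegral_rpow_enorm_toReal two_ne_zero ENNReal.ofNat_ne_top]
  have e : √δ / √2 * √s * √2 = (δ * s) ^ (1 / 2 : ℝ) := by
    rw [← Real.sqrt_eq_rpow, Real.sqrt_mul hδ.le]; field_simp
  rw [e, ← ENNReal.ofReal_rpow_of_nonneg (by positivity) (by positivity), ENNReal.toReal_ofNat]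
  refine ENNReal.rpow_le_rpow (hk1.trans (lintegral_mono fun x => le_of_eq ?_)) (by norm_num)
  rw [Real.enorm_eq_ofReal_abs, ENNReal.ofReal_rpow_of_nonneg (abs_nonneg _) (by norm_num)]
  congr 1
  rw [Real.rpow_ofNat, sq_abs]

/-! ### Exponential moments of squares of Gaussian variables -/

theorem lintegral_exp_mul_sq_gaussianReal {a : ℝ} {v : ℝ≥0} (h : 2 * a * v < 1) :
    ∫⁻ x, ENNReal.ofReal (Real.exp (a * x ^ 2)) ∂gaussianReal 0 v =
      ENNReal.ofReal (√(1 - 2 * a * v))⁻¹ := by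
  rcases eq_or_ne v 0 with rfl | hv
  · simp [gaussianReal_zero_var]
  have hv0 : (0 : ℝ) < v := by positivity
  -- The rate of the Gaussian density after tilting by `exp (a x²)`; it is positive exactly when the
  -- integral converges.
  set b : ℝ := (1 - 2 * a * v) / (2 * v) with hb
  have hb0 : 0 < b := div_pos (by linarith) (by positivity)
  have hA : 0 < 1 - 2 * a * v := by linarith
  rw [gaussianReal_of_var_ne_zero _ hv, lintegral_withDensity_eq_lintegral_mul _
    (measurable_gaussianPDF 0 v) (by fun_prop)]
  have e : ∀ x, (gaussianPDF 0 v * fun x => ENNReal.ofReal (Real.exp (a * x ^ 2))) x =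
      ENNReal.ofReal ((√(2 * Real.pi * v))⁻¹ * Real.exp (-b * x ^ 2)) := by
    intro x
    rw [Pi.mul_apply, gaussianPDF, ← ENNReal.ofReal_mul (gaussianPDFReal_nonneg _ _ _),
      gaussianPDFReal, mul_assoc, ← Real.exp_add]
    congr 3
    rw [hb]; field_simp; ring
  simp_rw [e]
  rw [← ofReal_integral_eq_lintegral_ofReal ((integrable_exp_neg_mul_sq hb0).const_mul _)
    (Eventually.of_forall fun x => by positivity), integral_const_mul, integral_gaussian]
  congr 1
  rw [← Real.sqrt_inv, ← Real.sqrt_inv, ← Real.sqrt_mul (by positivity)]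
  congr 1
  rw [hb]
  have := Real.pi_pos
  field_simp

/-- The product is `1 / √(A² - B²)`, which differs from `1 / A` only at order `B²`. For the
decoupling, `A = 1 - 2av` and `B = 2ac`. -/
theorem inv_sqrt_add_mul_inv_sqrt_sub_le {A B : ℝ} (hA : 3 / 4 ≤ A) (hB : |B| ≤ 1 / 4) :
    (√(A + B))⁻¹ * (√(A - B))⁻¹ ≤ (√A)⁻¹ ^ 2 + 4 * B ^ 2 := by
  have hB' := abs_le.1 hB
  have hB2 : B ^ 2 ≤ 1 / 16 := by nlinarith
  rw [← mul_inv, ← Real.sqrt_mul (by linarith), inv_pow, Real.sq_sqrt (by linarith)]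
  have hq : 1 / 2 ≤ A ^ 2 - B ^ 2 := by nlinarith
  rw [show (A + B) * (A - B) = A ^ 2 - B ^ 2 by ring]
  set r := √(A ^ 2 - B ^ 2) with hr
  have hr2 : r ^ 2 = A ^ 2 - B ^ 2 := Real.sq_sqrt (by linarith)
  have hr1 : 2 / 3 ≤ r := Real.le_sqrt_of_sq_le (by linarith)
  have hA0 : 0 < A := by linarith
  have hr0 : 0 < r := by linarith
  have h1 : A - r ≤ B ^ 2 := by nlinarith
  rw [inv_eq_one_div, inv_eq_one_div, div_add' _ _ _ hA0.ne', div_le_div_iff₀ hr0 hA0]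
  have h2 : 1 / 2 ≤ A * r := by nlinarith
  nlinarith [sq_nonneg B]

section WienerIntegral

variable {Ω : Type*} [MeasurableSpace Ω] {P : Measure Ω} {W : ℝ≥0 → BddBorelSet → Ω → ℝ}

theorem IsWienerIntegral.lintegral_exp_mul_sq (hW : IsSpaceTimeWhiteNoise W P)
    {φ : ℝ × ℝ → ℝ} {X : Ω → ℝ} (hX : IsWienerIntegral W P φ X)
    (hφ : Measurable φ) (hXm : AEMeasurable X P) {a : ℝ} (ha : 2 * a * ∫ z, φ z ^ 2 < 1) :
    ∫⁻ ω, ENNReal.ofReal (Real.exp (a * X ω ^ 2)) ∂P =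
      ENNReal.ofReal (√(1 - 2 * a * ∫ z, φ z ^ 2))⁻¹ := by
  have h0 : 0 ≤ ∫ z, φ z ^ 2 := integral_nonneg fun _ => sq_nonneg _
  have hm : Measurable fun x : ℝ => ENNReal.ofReal (Real.exp (a * x ^ 2)) := by fun_prop
  rw [← lintegral_map' hm.aemeasurable hXm, hX.map_eq hW hφ hXm,
    lintegral_exp_mul_sq_gaussianReal, Real.coe_toNNReal _ h0]
  rwa [Real.coe_toNNReal _ h0]

theorem IsWienerIntegral.variance_eq (hW : IsSpaceTimeWhiteNoise W P)
    {φ : ℝ × ℝ → ℝ} {X : Ω → ℝ} (hX : IsWienerIntegral W P φ X)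
    (hφ : Measurable φ) (hXm : AEMeasurable X P) : Var[X; P] = ∫ z, φ z ^ 2 := by
  have h := variance_map (X := id) (μ := P) (by fun_prop) hXm
  rw [hX.map_eq hW hφ hXm, variance_id_gaussianReal,
    Real.coe_toNNReal _ (integral_nonneg fun _ => sq_nonneg _)] at h
  exact h.symm

/-- Decoupling: `X² + Y² = ((X + Y)² + (X - Y)²) / 2`, and equal variances make `X + Y` and `X - Y`
uncorrelated, hence independent. The excess over the product of means is quadratic in the covariance
`c`. -/
theorem IsWienerIntegral.lintegral_exp_mul_sq_mul (hW : IsSpaceTimeWhiteNoise W P)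
    {φ ψ : ℝ × ℝ → ℝ} {X Y : Ω → ℝ}
    (hX : IsWienerIntegral W P φ X) (hY : IsWienerIntegral W P ψ Y)
    (hφ : Measurable φ) (hψ : Measurable ψ) (hXm : AEMeasurable X P) (hYm : AEMeasurable Y P)
    {a v c : ℝ} (hv : ∫ z, φ z ^ 2 = v) (hv' : ∫ z, ψ z ^ 2 = v) (hc : ∫ z, φ z * ψ z = c)
    (ha : |2 * a * v| ≤ 1 / 4) :
    ∫⁻ ω, ENNReal.ofReal (Real.exp (a * X ω ^ 2)) * ENNReal.ofReal (Real.exp (a * Y ω ^ 2)) ∂P ≤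
      ENNReal.ofReal (√(1 - 2 * a * v))⁻¹ ^ 2 + ENNReal.ofReal (16 * a ^ 2 * c ^ 2) := by
  have hφ2 := hX.memLp hφ
  have hψ2 := hY.memLp hψ
  have i1 : Integrable fun z => φ z ^ 2 := hφ2.integrable_sq
  have i2 : Integrable fun z => ψ z ^ 2 := hψ2.integrable_sq
  have i3 : Integrable fun z => φ z * ψ z := hφ2.integrable_mul hψ2
  have hneg := hY.const_mul (-1)
  have hadd := hX.add hW hY hφ hψ hXm hYm
  have hsub := hX.add hW hneg hφ (by fun_prop) hXm (by fun_prop)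
  have va : ∫ z, (φ z + ψ z) ^ 2 = 2 * (v + c) := by
    have : ∀ z, (φ z + ψ z) ^ 2 = φ z ^ 2 + ψ z ^ 2 + 2 * (φ z * ψ z) := fun z => by ring
    simp_rw [this]
    rw [integral_add (by fun_prop) (by fun_prop), integral_add i1 i2, integral_const_mul,
      hv, hv', hc]
    ring
  have vs : ∫ z, (φ z + -1 * ψ z) ^ 2 = 2 * (v - c) := by
    have : ∀ z, (φ z + -1 * ψ z) ^ 2 = φ z ^ 2 + ψ z ^ 2 - 2 * (φ z * ψ z) := fun z => by ring
    simp_rw [this]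
    rw [integral_sub (by fun_prop) (by fun_prop), integral_add i1 i2, integral_const_mul,
      hv, hv', hc]
    ring
  have hva : 0 ≤ 2 * (v + c) := va ▸ integral_nonneg fun _ => sq_nonneg _
  have hvs : 0 ≤ 2 * (v - c) := vs ▸ integral_nonneg fun _ => sq_nonneg _
  -- Cauchy–Schwarz, read off from the nonnegative variances of `X + Y` and `X - Y`.
  have hcv : |c| ≤ v := abs_le.2 ⟨by linarith, by linarith⟩
  have hv0 : 0 ≤ v := (abs_nonneg c).trans hcv
  have hB : |2 * a * c| ≤ 1 / 4 := by
    refine le_trans ?_ ha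
    rw [abs_mul, abs_mul (2 * a) v, abs_of_nonneg hv0]
    gcongr
  have hA := abs_le.1 ha
  have hB' := abs_le.1 hB
  have hpair := hadd.hasGaussianLaw_pair hW hsub (by fun_prop) (by fun_prop) (by fun_prop)
    (by fun_prop)
  have hgp := hX.hasGaussianLaw_pair hW hY hφ hψ hXm hYm
  have hP := hgp.isProbabilityMeasure
  have hX2 : MemLp X 2 P := hgp.fst.memLp_two
  have hY2 : MemLp Y 2 P := hgp.snd.memLp_two
  have hcov : cov[fun ω => X ω + Y ω, fun ω => X ω + -1 * Y ω; P] = 0 := by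
    have hY2' : MemLp (fun ω => -1 * Y ω) 2 P := hY2.const_mul _
    change cov[X + Y, X + fun ω => -1 * Y ω; P] = 0
    rw [covariance_add_left hX2 hY2 (hX2.add hY2'), covariance_add_right hX2 hX2 hY2',
      covariance_add_right hY2 hX2 hY2', covariance_const_mul_right,
      covariance_const_mul_right, covariance_self hXm, covariance_self hYm,
      hX.variance_eq hW hφ hXm, hY.variance_eq hW hψ hYm, hv, hv', covariance_comm Y X]
    ring
  have hind := hpair.indepFun_of_covariance_eq_zero hcov
  set e : ℝ → ℝ≥0∞ := fun x => ENNReal.ofReal (Real.exp (a / 2 * x ^ 2)) with he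
  have hem : Measurable e := by fun_prop
  calc ∫⁻ ω, ENNReal.ofReal (Real.exp (a * X ω ^ 2)) *
        ENNReal.ofReal (Real.exp (a * Y ω ^ 2)) ∂P
      = ∫⁻ ω, e (X ω + Y ω) * e (X ω + -1 * Y ω) ∂P := by
        refine lintegral_congr fun ω => ?_
        rw [he]
        simp only
        rw [← ENNReal.ofReal_mul (by positivity), ← ENNReal.ofReal_mul (by positivity),
          ← Real.exp_add, ← Real.exp_add]
        congr 2; ring
    _ = (∫⁻ ω, e (X ω + Y ω) ∂P) * ∫⁻ ω, e (X ω + -1 * Y ω) ∂P :=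
        lintegral_mul_eq_lintegral_mul_lintegral_of_indepFun''
          (by fun_prop) (by fun_prop) (hind.comp hem hem)
    _ = ENNReal.ofReal (√((1 - 2 * a * v) - 2 * a * c))⁻¹ *
          ENNReal.ofReal (√((1 - 2 * a * v) + 2 * a * c))⁻¹ := by
        rw [hadd.lintegral_exp_mul_sq hW (by fun_prop) (by fun_prop) (by rw [va]; linarith),
          hsub.lintegral_exp_mul_sq hW (by fun_prop) (by fun_prop) (by rw [vs]; linarith), va, vs]
        rw [show 1 - 2 * (a / 2) * (2 * (v + c)) = 1 - 2 * a * v - 2 * a * c by ring,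
          show 1 - 2 * (a / 2) * (2 * (v - c)) = 1 - 2 * a * v + 2 * a * c by ring]
    _ ≤ ENNReal.ofReal ((√(1 - 2 * a * v))⁻¹ ^ 2 + 4 * (2 * a * c) ^ 2) := by
        rw [← ENNReal.ofReal_mul (by positivity), mul_comm]
        exact ENNReal.ofReal_le_ofReal
          (inv_sqrt_add_mul_inv_sqrt_sub_le (by linarith) hB)
    _ = _ := by
        rw [ENNReal.ofReal_add (by positivity) (by positivity),
          ENNReal.ofReal_pow (by positivity)]
        congr 2; ring

end WienerIntegral

/-! ### Concentration of averages over space -/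

/-- Second moment bound for the fluctuation of a spatial average of a nonnegative random field with
constant mean. -/
theorem lintegral_sq_average_sub_le {α Ω : Type*} [MeasurableSpace α] [MeasurableSpace Ω]
    {μ : Measure α} [IsFiniteMeasure μ] {P : Measure Ω} [IsProbabilityMeasure P]
    {F : α → Ω → ℝ≥0∞} (hF : Measurable fun z : α × Ω => F z.1 z.2) {m : ℝ} (hm : 0 ≤ m)
    {K : α → α → ℝ≥0∞} (hE : ∀ᵐ x ∂μ, ∫⁻ ω, F x ω ∂P = ENNReal.ofReal m)
    (hC : ∀ᵐ x ∂μ, ∀ᵐ y ∂μ, ∫⁻ ω, F x ω * F y ω ∂P ≤ ENNReal.ofReal m ^ 2 + K x y) :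
    ∫⁻ ω, ENNReal.ofReal (((∫⁻ x, F x ω ∂μ).toReal - μ.real univ * m) ^ 2) ∂P ≤
      ∫⁻ x, ∫⁻ y, K x y ∂μ ∂μ := by
  set Z : Ω → ℝ≥0∞ := fun ω => ∫⁻ x, F x ω ∂μ with hZ
  set M : ℝ := μ.real univ * m with hM
  have hM0 : 0 ≤ M := by positivity
  have hMe : ENNReal.ofReal M = ENNReal.ofReal m * μ univ := by
    rw [hM, ENNReal.ofReal_mul measureReal_nonneg, ofReal_measureReal, mul_comm]
  have hZm : Measurable Z := hF.lintegral_prod_left'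
  have hFx : ∀ x, Measurable (F x) := fun x => hF.comp measurable_prodMk_left
  have hFω : ∀ ω, Measurable fun x => F x ω := fun ω => hF.comp measurable_prodMk_right
  have hEZ : ∫⁻ ω, Z ω ∂P = ENNReal.ofReal M := by
    rw [hZ, lintegral_lintegral_swap (f := fun ω x => F x ω) (hF.comp measurable_swap).aemeasurable,
      lintegral_congr_ae hE, lintegral_const, hMe]
  have hEZ2 : ∫⁻ ω, Z ω ^ 2 ∂P ≤ ENNReal.ofReal M ^ 2 + ∫⁻ x, ∫⁻ y, K x y ∂μ ∂μ := by
    have h3 : Measurable fun z : Ω × α × α => F z.2.1 z.1 * F z.2.2 z.1 :=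
      (hF.comp (measurable_snd.fst.prodMk measurable_fst)).mul
        (hF.comp (measurable_snd.snd.prodMk measurable_fst))
    have e1 : ∀ ω, Z ω ^ 2 = ∫⁻ z, F z.1 ω * F z.2 ω ∂(μ.prod μ) := by
      intro ω
      rw [sq, hZ, lintegral_prod_mul (hFω ω).aemeasurable (hFω ω).aemeasurable]
    simp_rw [e1]
    rw [lintegral_lintegral_swap h3.aemeasurable,
      lintegral_prod _ (by
        exact (h3.comp measurable_swap).lintegral_prod_right'.aemeasurable)]
    calc _ ≤ ∫⁻ x, ∫⁻ y, (ENNReal.ofReal m ^ 2 + K x y) ∂μ ∂μ := by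
          refine lintegral_mono_ae ?_
          filter_upwards [hC] with x hx
          exact lintegral_mono_ae hx
      _ = _ := by
          simp_rw [lintegral_add_left measurable_const, lintegral_const, hMe]
          ring
  have hZfin : ∀ᵐ ω ∂P, Z ω < ∞ := ae_lt_top hZm (by rw [hEZ]; exact ENNReal.ofReal_ne_top)
  -- The expanded square, with the cross term moved to the left to avoid truncated subtraction; that
  -- term has finite expectation and is cancelled at the end.
  have hkey : ∀ᵐ ω ∂P, ENNReal.ofReal (((Z ω).toReal - M) ^ 2) + 2 * ENNReal.ofReal M * Z ω =
      Z ω ^ 2 + ENNReal.ofReal M ^ 2 := by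
    filter_upwards [hZfin] with ω hω
    have hz : Z ω = ENNReal.ofReal (Z ω).toReal := (ENNReal.ofReal_toReal hω.ne).symm
    have hr : 0 ≤ (Z ω).toReal := ENNReal.toReal_nonneg
    generalize (Z ω).toReal = r at hz hr ⊢
    rw [hz, ← ENNReal.ofReal_ofNat 2, ← ENNReal.ofReal_mul (by norm_num),
      ← ENNReal.ofReal_mul (by positivity), ← ENNReal.ofReal_pow hr, ← ENNReal.ofReal_pow hM0,
      ← ENNReal.ofReal_add (by positivity) (by positivity),
      ← ENNReal.ofReal_add (by positivity) (by positivity)]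
    congr 1; ring
  have hsum := lintegral_congr_ae hkey
  rw [lintegral_add_right _ (hZm.const_mul _), lintegral_const_mul _ hZm, hEZ,
    lintegral_add_right _ measurable_const, lintegral_const, measure_univ, mul_one] at hsum
  have hfin : 2 * ENNReal.ofReal M * ENNReal.ofReal M ≠ ∞ := by finiteness
  refine (ENNReal.add_le_add_iff_right hfin).1 ?_
  rw [hsum]
  calc _ ≤ (ENNReal.ofReal M ^ 2 + ∫⁻ x, ∫⁻ y, K x y ∂μ ∂μ) + ENNReal.ofReal M ^ 2 := by gcongr
    _ = _ := by ring

/-- Real sequences whose squares have summable expectations tend to zero almost surely. -/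
theorem ae_tendsto_zero_of_tsum_lintegral_sq_ne_top {Ω : Type*} [MeasurableSpace Ω]
    {P : Measure Ω} {X : ℕ → Ω → ℝ} (hX : ∀ k, Measurable (X k))
    (h : ∑' k, ∫⁻ ω, ENNReal.ofReal (X k ω ^ 2) ∂P ≠ ∞) :
    ∀ᵐ ω ∂P, Tendsto (fun k => X k ω) atTop (𝓝 0) := by
  have hm : ∀ k, Measurable fun ω => ENNReal.ofReal (X k ω ^ 2) := fun k =>
    ((hX k).pow_const 2).ennreal_ofReal
  rw [← lintegral_tsum fun k => (hm k).aemeasurable] at h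
  filter_upwards [ae_lt_top (Measurable.tsum hm) h] with ω hω
  have h1 := ENNReal.tendsto_atTop_zero_of_tsum_ne_top hω.ne
  have h2 := (ENNReal.tendsto_toReal ENNReal.zero_ne_top).comp h1
  have h3 : Tendsto (fun k => √(X k ω ^ 2)) atTop (𝓝 0) := by
    have := (Real.continuous_sqrt.tendsto _).comp h2
    simpa [Function.comp_def, ENNReal.toReal_ofReal (sq_nonneg _)] using this
  simp_rw [Real.sqrt_sq_eq_abs] at h3
  exact (tendsto_zero_iff_abs_tendsto_zero _).2 h3

/-! ### Increments of the mild solution -/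

theorem integral_mildKernel_mul_eq {t : ℝ} (ht : 0 < t) {x y : ℝ}
    (hx : MemLp (mildKernel t x) 2 volume) (hy : MemLp (mildKernel t y) 2 volume) :
    ∫ z, mildKernel t x z * mildKernel t y z = mildCov t |x - y| := by
  rw [integral_mildKernel_mul ht x y hx hy, integral_heatKernelTwo ht]

/-- The integrand representing the increment of the mild solution from `x` to `x + h`. -/
noncomputable def mildInc (t h x : ℝ) (z : ℝ × ℝ) : ℝ :=
  mildKernel t (x + h) z + -1 * mildKernel t x z

theorem measurable_mildInc (t h x : ℝ) : Measurable (mildInc t h x) :=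
  (measurable_mildKernel t (x + h)).add ((measurable_mildKernel t x).const_mul _)

/-- The covariance of two increments of the mild solution over a distance `h`, with base points at
distance `z`. -/
noncomputable def mildIncCov (t h z : ℝ) : ℝ :=
  2 * mildCov t |z| - mildCov t |z + h| - mildCov t |z - h|

theorem mildIncCov_zero {t h : ℝ} (hh : 0 ≤ h) : mildIncCov t h 0 = mildVar t h := by
  simp only [mildIncCov, mildVar, abs_zero, zero_add, zero_sub, abs_neg, abs_of_nonneg hh]
  ring

theorem integral_mildInc_mul {t : ℝ} (ht : 0 < t) (h : ℝ) {x y : ℝ}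
    (hx : MemLp (mildKernel t x) 2 volume) (hx' : MemLp (mildKernel t (x + h)) 2 volume)
    (hy : MemLp (mildKernel t y) 2 volume) (hy' : MemLp (mildKernel t (y + h)) 2 volume) :
    ∫ z, mildInc t h x z * mildInc t h y z = mildIncCov t h (x - y) := by
  have i1 := hx.integrable_mul hy
  have i2 := hx'.integrable_mul hy
  have i3 := hx.integrable_mul hy'
  have i4 := hx'.integrable_mul hy'
  have e : (fun z => mildInc t h x z * mildInc t h y z) =
      (mildKernel t (x + h) * mildKernel t (y + h) - mildKernel t (x + h) * mildKernel t y) -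
        (mildKernel t x * mildKernel t (y + h) - mildKernel t x * mildKernel t y) := by
    ext z
    simp only [mildInc, Pi.sub_apply, Pi.mul_apply]
    ring
  rw [e, integral_sub' (i4.sub i2) (i3.sub i1), integral_sub' i4 i2, integral_sub' i3 i1]
  simp only [Pi.mul_apply]
  rw [integral_mildKernel_mul_eq ht hx hy, integral_mildKernel_mul_eq ht hx' hy,
    integral_mildKernel_mul_eq ht hx hy', integral_mildKernel_mul_eq ht hx' hy', mildIncCov,
    show x + h - (y + h) = x - y by ring, show x + h - y = x - y + h by ring,
    show x - (y + h) = x - y - h by ring]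
  ring

/-- The supremum of the heat kernel at time `2 t`. -/
noncomputable def heatBound (t : ℝ) : ℝ := (2 * √Real.pi * √t)⁻¹

/-- The covariance has a kink at distance `0`. For `|z| ≥ h` the three arguments lie on one side of
it, so the second difference of the smooth function `mildCov t` applies. -/
theorem abs_mildIncCov_le_of_le_abs {t : ℝ} (ht : 0 < t) {h z : ℝ} (hh : 0 ≤ h) (hz : h ≤ |z|) :
    |mildIncCov t h z| ≤ 2 * heatBound t * h ^ 2 := by
  have key : ∀ w, h ≤ w → |mildIncCov t h w| ≤ 2 * heatBound t * h ^ 2 := fun w hw => by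
    rw [mildIncCov, abs_of_nonneg (hh.trans hw), abs_of_nonneg (by linarith : 0 ≤ w + h),
      abs_of_nonneg (by linarith : 0 ≤ w - h)]
    exact abs_mildCov_second_difference_le ht w h
  have hneg : mildIncCov t h (-z) = mildIncCov t h z := by
    rw [mildIncCov, mildIncCov, abs_neg, show -z + h = -(z - h) by ring,
      show -z - h = -(z + h) by ring, abs_neg, abs_neg]
    ring
  rcases abs_choice z with h' | h' <;> rw [h'] at hz
  · exact key z hz
  · rw [← hneg]; exact key _ hz

/-- Cauchy–Schwarz for equal norms; it controls increments whose intervals overlap. -/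
theorem abs_integral_mul_le {α : Type*} [MeasurableSpace α] {μ : Measure α} {f g : α → ℝ} {v : ℝ}
    (hf : MemLp f 2 μ) (hg : MemLp g 2 μ) (hfv : ∫ z, f z ^ 2 ∂μ = v) (hgv : ∫ z, g z ^ 2 ∂μ = v) :
    |∫ z, f z * g z ∂μ| ≤ v := by
  have i1 : Integrable (fun z => f z ^ 2) μ := hf.integrable_sq
  have i2 : Integrable (fun z => g z ^ 2) μ := hg.integrable_sq
  calc |∫ z, f z * g z ∂μ| ≤ ∫ z, |f z * g z| ∂μ := abs_integral_le_integral_abs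
    _ ≤ ∫ z, (f z ^ 2 + g z ^ 2) / 2 ∂μ := by
        refine integral_mono (hf.integrable_mul hg).abs ((i1.add i2).div_const 2) fun z => ?_
        refine abs_le.2 ⟨?_, ?_⟩ <;> simp only <;>
          nlinarith [sq_nonneg (f z - g z), sq_nonneg (f z + g z)]
    _ = v := by rw [integral_div, integral_add i1 i2, hfv, hgv]; ring

section Field

variable {Ω : Type*} [MeasurableSpace Ω] {P : Measure Ω} {W : ℝ≥0 → BddBorelSet → Ω → ℝ}

theorem IsWienerIntegral.congr_ae {φ : ℝ × ℝ → ℝ} {X Y : Ω → ℝ}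
    (hX : IsWienerIntegral W P φ X) (h : X =ᵐ[P] Y) : IsWienerIntegral W P φ Y := by
  obtain ⟨c, hc, hI⟩ := hX
  refine ⟨c, hc, hI.congr fun n => eLpNorm_congr_ae ?_⟩
  filter_upwards [h] with ω hω
  rw [hω]

theorem isWienerIntegral_increment (hW : IsSpaceTimeWhiteNoise W P) {t : ℝ} {g : ℝ × Ω → ℝ}
    (hg : Measurable g) {x h : ℝ}
    (hx : IsWienerIntegral W P (mildKernel t x) fun ω => g (x, ω))
    (hxh : IsWienerIntegral W P (mildKernel t (x + h)) fun ω => g (x + h, ω)) :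
    IsWienerIntegral W P (mildInc t h x) fun ω => g (x + h, ω) - g (x, ω) := by
  have hm : ∀ y : ℝ, Measurable fun ω => g (y, ω) := fun y => hg.comp measurable_prodMk_left
  have := hxh.add hW (hx.const_mul (-1)) (measurable_mildKernel t _)
    ((measurable_mildKernel t x).const_mul _) (hm _).aemeasurable
    ((hm x).const_mul _).aemeasurable
  have e : (fun ω => g (x + h, ω) + -1 * g (x, ω)) = fun ω => g (x + h, ω) - g (x, ω) := by
    ext ω; ring
  rw [← e]
  exact this

theorem ae_isWienerIntegral_pair {t : ℝ} {g : ℝ × Ω → ℝ}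
    (hgW : ∀ᵐ x ∂volume.restrict (Icc (0 : ℝ) 1),
      IsWienerIntegral W P (mildKernel t x) fun ω => g (x, ω)) {h : ℝ} (hh : 0 ≤ h) :
    ∀ᵐ x ∂volume.restrict (Icc (0 : ℝ) (1 - h)),
      IsWienerIntegral W P (mildKernel t x) (fun ω => g (x, ω)) ∧
      IsWienerIntegral W P (mildKernel t (x + h)) fun ω => g (x + h, ω) := by
  have hgW' := (ae_restrict_iff' measurableSet_Icc).1 hgW
  refine (ae_restrict_iff' measurableSet_Icc).2 ?_
  filter_upwards [hgW', (measurePreserving_add_right volume h).quasiMeasurePreserving.ae hgW']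
    with x h1 h2 hx
  exact ⟨h1 ⟨hx.1, by linarith [hx.2]⟩, h2 ⟨by linarith [hx.1], by linarith [hx.2]⟩⟩

theorem integral_sq_mildInc {t : ℝ} (ht : 0 < t) {h : ℝ} (hh : 0 ≤ h) {x : ℝ} {X Y : Ω → ℝ}
    (hx : IsWienerIntegral W P (mildKernel t x) X)
    (hxh : IsWienerIntegral W P (mildKernel t (x + h)) Y) :
    ∫ z, mildInc t h x z ^ 2 = mildVar t h := by
  have m1 := hx.memLp (measurable_mildKernel t _)
  have m2 := hxh.memLp (measurable_mildKernel t _)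
  simp_rw [sq]
  rw [integral_mildInc_mul ht h m1 m2 m1 m2, sub_self, mildIncCov_zero hh]

/-- The choice `|a| = 1/16` meets, with room to spare, the smallness condition of the decoupling
bound. -/
theorem abs_two_mul_div_mul_mildVar_le {t : ℝ} (ht : 0 < t) {h : ℝ} (hh : 0 < h) {a : ℝ}
    (ha : |a| = 1 / 16) (h0 : 0 ≤ mildVar t h) : |2 * (a / h) * mildVar t h| ≤ 1 / 4 := by
  have hvh := mildVar_le ht hh.le
  rw [abs_mul, abs_mul, abs_div, ha, abs_of_nonneg h0, abs_of_pos hh, abs_two]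
  calc 2 * (1 / 16 / h) * mildVar t h ≤ 2 * (1 / 16 / h) * h := by gcongr
    _ ≤ 1 / 4 := by field_simp; norm_num

theorem lintegral_exp_increment (hW : IsSpaceTimeWhiteNoise W P) {t : ℝ} (ht : 0 < t)
    {g : ℝ × Ω → ℝ} (hg : Measurable g) {x h : ℝ} (hh : 0 < h)
    (hx : IsWienerIntegral W P (mildKernel t x) fun ω => g (x, ω))
    (hxh : IsWienerIntegral W P (mildKernel t (x + h)) fun ω => g (x + h, ω))
    {a : ℝ} (ha : |a| = 1 / 16) :
    ∫⁻ ω, ENNReal.ofReal (Real.exp (a / h * (g (x + h, ω) - g (x, ω)) ^ 2)) ∂P =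
      ENNReal.ofReal (√(1 - 2 * (a / h) * mildVar t h))⁻¹ := by
  have hv := integral_sq_mildInc ht hh.le hx hxh
  have h0 : 0 ≤ mildVar t h := hv ▸ integral_nonneg fun _ => sq_nonneg _
  have hm : Measurable fun ω => g (x + h, ω) - g (x, ω) :=
    (hg.comp measurable_prodMk_left).sub (hg.comp measurable_prodMk_left)
  rw [(isWienerIntegral_increment hW hg hx hxh).lintegral_exp_mul_sq hW
    (measurable_mildInc t h x) hm.aemeasurable, hv]
  rw [hv]
  linarith [(abs_le.1 (abs_two_mul_div_mul_mildVar_le ht hh ha h0)).2]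

theorem measurable_exp_increment {g : ℝ × Ω → ℝ} (hg : Measurable g) (b h : ℝ) :
    Measurable fun z : ℝ × Ω =>
      ENNReal.ofReal (Real.exp (b * (g (z.1 + h, z.2) - g (z.1, z.2)) ^ 2)) := by
  have h1 : Measurable fun z : ℝ × Ω => g (z.1 + h, z.2) :=
    hg.comp ((measurable_fst.add_const h).prodMk measurable_snd)
  have h2 : Measurable fun z : ℝ × Ω => g (z.1, z.2) := hg
  fun_prop

/-- Concentration of the exponential averages of the increments over a distance `h`. -/
theorem lintegral_sq_exp_average_sub_le (hW : IsSpaceTimeWhiteNoise W P) {t : ℝ} (ht : 0 < t)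
    {g : ℝ × Ω → ℝ} (hg : Measurable g)
    (hgW : ∀ᵐ x ∂volume.restrict (Icc (0 : ℝ) 1),
      IsWienerIntegral W P (mildKernel t x) fun ω => g (x, ω))
    {h : ℝ} (hh : 0 < h) (hh1 : h ≤ 1) {a : ℝ} (ha : |a| = 1 / 16) :
    ∫⁻ ω, ENNReal.ofReal (((∫⁻ x in Icc 0 (1 - h),
        ENNReal.ofReal (Real.exp (a / h * (g (x + h, ω) - g (x, ω)) ^ 2))).toReal -
        (1 - h) * (√(1 - 2 * (a / h) * mildVar t h))⁻¹) ^ 2) ∂P ≤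
      ENNReal.ofReal ((heatBound t ^ 2 + 2) * h) := by
  have hP : IsProbabilityMeasure P :=
    (hasGaussianLaw_elementaryIntegral hW 0).isProbabilityMeasure
  have hgood := ae_isWienerIntegral_pair hgW hh.le
  have hm : ∀ x, Measurable fun ω => g (x + h, ω) - g (x, ω) := fun x =>
    (hg.comp measurable_prodMk_left).sub (hg.comp measurable_prodMk_left)
  have hvh := mildVar_le ht hh.le
  -- Order `h²` for separated base points, and order `1` on the band `|x - y| < h`; the band has
  -- width `2h`, so the double integral is `O(h)`.
  set K : ℝ → ℝ → ℝ≥0∞ := fun x y => ENNReal.ofReal (heatBound t ^ 2 * h ^ 2) +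
    (Ioo (x - h) (x + h)).indicator 1 y with hK
  have hreal : (volume.restrict (Icc (0 : ℝ) (1 - h))).real univ = 1 - h := by
    simp [Measure.real, hh1]
  have main := lintegral_sq_average_sub_le (μ := volume.restrict (Icc (0 : ℝ) (1 - h))) (P := P)
    (F := fun x ω => ENNReal.ofReal (Real.exp (a / h * (g (x + h, ω) - g (x, ω)) ^ 2)))
    (measurable_exp_increment hg (a / h) h)
    (m := (√(1 - 2 * (a / h) * mildVar t h))⁻¹) (by positivity) (K := K) ?_ ?_
  · rw [hreal] at main
    refine main.trans ?_
    have hy : ∀ x, ∫⁻ y, K x y ∂volume.restrict (Icc (0 : ℝ) (1 - h)) ≤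
        ENNReal.ofReal ((heatBound t ^ 2 + 2) * h) := by
      intro x
      rw [hK, lintegral_add_left measurable_const, lintegral_const,
        lintegral_indicator_one measurableSet_Ioo, Measure.restrict_apply_univ, Real.volume_Icc]
      calc _ ≤ ENNReal.ofReal (heatBound t ^ 2 * h ^ 2) * 1 + volume (Ioo (x - h) (x + h)) := by
            gcongr
            · exact ENNReal.ofReal_le_one.2 (by linarith)
            · exact Measure.restrict_le_self
        _ ≤ _ := by
            rw [Real.volume_Ioo, mul_one, ← ENNReal.ofReal_add (by positivity) (by linarith)]
            refine ENNReal.ofReal_le_ofReal ?_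
            have : heatBound t ^ 2 * h ^ 2 ≤ heatBound t ^ 2 * h := by
              gcongr; nlinarith
            linarith
    calc _ ≤ ∫⁻ _, ENNReal.ofReal ((heatBound t ^ 2 + 2) * h)
          ∂volume.restrict (Icc (0 : ℝ) (1 - h)) := lintegral_mono hy
      _ ≤ ENNReal.ofReal ((heatBound t ^ 2 + 2) * h) * 1 := by
          rw [lintegral_const, Measure.restrict_apply_univ, Real.volume_Icc]
          gcongr
          exact ENNReal.ofReal_le_one.2 (by linarith)
      _ = _ := mul_one _
  · filter_upwards [hgood] with x hx
    exact lintegral_exp_increment hW ht hg hh hx.1 hx.2 ha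
  · filter_upwards [hgood] with x hx
    filter_upwards [hgood] with y hy
    have hv := integral_sq_mildInc ht hh.le hx.1 hx.2
    have hv' := integral_sq_mildInc ht hh.le hy.1 hy.2
    have h0 : 0 ≤ mildVar t h := hv ▸ integral_nonneg fun _ => sq_nonneg _
    have iX := isWienerIntegral_increment hW hg hx.1 hx.2
    have iY := isWienerIntegral_increment hW hg hy.1 hy.2
    have hc := integral_mildInc_mul ht h (hx.1.memLp (measurable_mildKernel t _))
      (hx.2.memLp (measurable_mildKernel t _)) (hy.1.memLp (measurable_mildKernel t _))
      (hy.2.memLp (measurable_mildKernel t _))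
    refine (iX.lintegral_exp_mul_sq_mul hW iY (measurable_mildInc t h x)
      (measurable_mildInc t h y) (hm x).aemeasurable (hm y).aemeasurable hv hv' hc
      (abs_two_mul_div_mul_mildVar_le ht hh ha h0)).trans ?_
    gcongr
    have ha2 : (a / h) ^ 2 = 1 / (256 * h ^ 2) := by
      rw [div_pow, ← sq_abs, ha]; field_simp; norm_num
    rw [ha2]
    by_cases hxy : h ≤ |x - y|
    · refine le_trans (ENNReal.ofReal_le_ofReal ?_) le_self_add
      have h1 := abs_mildIncCov_le_of_le_abs ht hh.le hxy
      have h2 : mildIncCov t h (x - y) ^ 2 ≤ (2 * heatBound t * h ^ 2) ^ 2 := by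
        rw [← sq_abs]; gcongr
      calc 16 * (1 / (256 * h ^ 2)) * mildIncCov t h (x - y) ^ 2
          ≤ 16 * (1 / (256 * h ^ 2)) * (2 * heatBound t * h ^ 2) ^ 2 := by gcongr
        _ = heatBound t ^ 2 * h ^ 2 / 4 := by field_simp; ring
        _ ≤ _ := by nlinarith [sq_nonneg (heatBound t * h)]
    · have hmem : y ∈ Ioo (x - h) (x + h) := by
        have := abs_lt.1 (not_le.1 hxy)
        exact ⟨by linarith [this.2], by linarith [this.1]⟩
      simp only [hK]
      rw [indicator_of_mem hmem]
      refine le_trans (ENNReal.ofReal_le_one.2 ?_) le_add_self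
      have h1 : |mildIncCov t h (x - y)| ≤ h := by
        rw [← hc]
        exact (abs_integral_mul_le (iX.memLp (measurable_mildInc t h x))
          (iY.memLp (measurable_mildInc t h y)) hv hv').trans hvh
      have h2 : mildIncCov t h (x - y) ^ 2 ≤ h ^ 2 := by
        rw [← sq_abs]; gcongr
      calc 16 * (1 / (256 * h ^ 2)) * mildIncCov t h (x - y) ^ 2
          ≤ 16 * (1 / (256 * h ^ 2)) * h ^ 2 := by gcongr
        _ ≤ 1 := by field_simp; norm_num

end Field

/-! ### Almost sure behaviour along dyadic scales -/

section Field

variable {Ω : Type*} [MeasurableSpace Ω] {P : Measure Ω} {W : ℝ≥0 → BddBorelSet → Ω → ℝ}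

/-- The average of `exp (a (g (x + h) - g x) ^ 2 / h)` over the dyadic scale `h = 2 ^ (-k)`. -/
noncomputable def dyadicExpAverage (g : ℝ × Ω → ℝ) (a : ℝ) (k : ℕ) (ω : Ω) : ℝ≥0∞ :=
  ∫⁻ x in Icc 0 (1 - (1 / 2) ^ k), ENNReal.ofReal
    (Real.exp (a / (1 / 2) ^ k * (g (x + (1 / 2) ^ k, ω) - g (x, ω)) ^ 2))

/-- The expectation of `dyadicExpAverage`. -/
noncomputable def dyadicExpMean (t a : ℝ) (k : ℕ) : ℝ :=
  (1 - (1 / 2) ^ k) * (√(1 - 2 * (a / (1 / 2) ^ k) * mildVar t ((1 / 2) ^ k)))⁻¹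

theorem measurable_dyadicExpAverage {g : ℝ × Ω → ℝ} (hg : Measurable g) (a : ℝ) (k : ℕ) :
    Measurable (dyadicExpAverage g a k) :=
  (measurable_exp_increment hg _ _).lintegral_prod_left'

/-- The variance bound is linear in `h = 2^(-k)`, hence summable. -/
theorem ae_tendsto_dyadicExpAverage_sub (hW : IsSpaceTimeWhiteNoise W P) {t : ℝ} (ht : 0 < t)
    {g : ℝ × Ω → ℝ} (hg : Measurable g)
    (hgW : ∀ᵐ x ∂volume.restrict (Icc (0 : ℝ) 1),
      IsWienerIntegral W P (mildKernel t x) fun ω => g (x, ω))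
    {a : ℝ} (ha : |a| = 1 / 16) :
    ∀ᵐ ω ∂P, Tendsto (fun k => (dyadicExpAverage g a k ω).toReal - dyadicExpMean t a k)
      atTop (𝓝 0) := by
  refine ae_tendsto_zero_of_tsum_lintegral_sq_ne_top
    (fun k => (measurable_dyadicExpAverage hg a k).ennreal_toReal.sub_const _) ?_
  refine ne_top_of_le_ne_top ?_ (ENNReal.tsum_le_tsum fun k =>
    lintegral_sq_exp_average_sub_le hW ht hg hgW (h := (1 / 2) ^ k) (by positivity)
      (pow_le_one₀ (by norm_num) (by norm_num)) ha)
  exact ((summable_geometric_of_lt_one (by norm_num) (by norm_num : (1 / 2 : ℝ) < 1)).mul_left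
    (heatBound t ^ 2 + 2)).tsum_ofReal_ne_top

theorem tendsto_half_pow : Tendsto (fun k : ℕ => (1 / 2 : ℝ) ^ k) atTop (𝓝 0) :=
  tendsto_pow_atTop_nhds_zero_of_lt_one (by norm_num) (by norm_num)

theorem ae_lintegral_ne_top {α : Type*} [MeasurableSpace α] {μ : Measure α} [IsFiniteMeasure μ]
    [SFinite P] {F : α → Ω → ℝ≥0∞} (hF : Measurable fun z : α × Ω => F z.1 z.2) {m : ℝ≥0∞}
    (hm : m ≠ ∞) (h : ∀ᵐ x ∂μ, ∫⁻ ω, F x ω ∂P = m) :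
    ∀ᵐ ω ∂P, ∫⁻ x, F x ω ∂μ ≠ ∞ := by
  have hlt : ∫⁻ ω, (∫⁻ x, F x ω ∂μ) ∂P ≠ ∞ := by
    rw [lintegral_lintegral_swap (f := fun ω x => F x ω) (hF.comp measurable_swap).aemeasurable,
      lintegral_congr_ae h, lintegral_const]
    finiteness
  filter_upwards [ae_lt_top hF.lintegral_prod_left' hlt] with ω hω
  exact hω.ne

theorem lintegral_exp_sq_ae_ne_top (hW : IsSpaceTimeWhiteNoise W P) {t : ℝ} (ht : 0 < t)
    {g : ℝ × Ω → ℝ} (hg : Measurable g)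
    (hgW : ∀ᵐ x ∂volume.restrict (Icc (0 : ℝ) 1),
      IsWienerIntegral W P (mildKernel t x) fun ω => g (x, ω)) :
    ∃ a : ℝ, 0 < a ∧ ∀ᵐ ω ∂P,
      ∫⁻ x in Icc 0 1, ENNReal.ofReal (Real.exp (a * g (x, ω) ^ 2)) ≠ ∞ := by
  have hP : IsProbabilityMeasure P :=
    (hasGaussianLaw_elementaryIntegral hW 0).isProbabilityMeasure
  have hR : 0 ≤ mildCov t 0 := by simp only [mildCov]; simp; positivity
  -- Any `a` with `2 a R(0) < 1` works; adding `1` keeps the denominator positive.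
  set a : ℝ := 1 / (4 * (mildCov t 0 + 1)) with ha
  have ha0 : 0 < a := by positivity
  have h1 : 2 * a * mildCov t 0 < 1 := by
    rw [ha, ← sub_pos]
    have : 1 - 2 * (1 / (4 * (mildCov t 0 + 1))) * mildCov t 0 =
      (2 * mildCov t 0 + 4) / (4 * (mildCov t 0 + 1)) := by field_simp; ring
    rw [this]; positivity
  refine ⟨a, ha0, ?_⟩
  have hF : Measurable fun z : ℝ × Ω => ENNReal.ofReal (Real.exp (a * g (z.1, z.2) ^ 2)) := by
    have h2 : Measurable fun z : ℝ × Ω => g (z.1, z.2) := hg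
    fun_prop
  refine ae_lintegral_ne_top hF (m := ENNReal.ofReal (√(1 - 2 * a * mildCov t 0))⁻¹)
    ENNReal.ofReal_ne_top ?_
  filter_upwards [hgW] with x hx
  have hm := hx.memLp (measurable_mildKernel t x)
  have hv : ∫ z, mildKernel t x z ^ 2 = mildCov t 0 := by
    simp_rw [sq]
    rw [integral_mildKernel_mul_eq ht hm hm, sub_self, abs_zero]
  rw [hx.lintegral_exp_mul_sq hW (measurable_mildKernel t x)
    (hg.comp measurable_prodMk_left).aemeasurable (by rwa [hv]), hv]

/-- Needed separately: the convergence of the averages concerns `toReal`, which sends `∞` to `0`. -/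
theorem dyadicExpAverage_ae_ne_top (hW : IsSpaceTimeWhiteNoise W P) {t : ℝ} (ht : 0 < t)
    {g : ℝ × Ω → ℝ} (hg : Measurable g)
    (hgW : ∀ᵐ x ∂volume.restrict (Icc (0 : ℝ) 1),
      IsWienerIntegral W P (mildKernel t x) fun ω => g (x, ω)) :
    ∀ᵐ ω ∂P, ∀ k, dyadicExpAverage g (1 / 16) k ω ≠ ∞ := by
  have hP : IsProbabilityMeasure P :=
    (hasGaussianLaw_elementaryIntegral hW 0).isProbabilityMeasure
  refine ae_all_iff.2 fun k => ae_lintegral_ne_top (measurable_exp_increment hg _ _)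
    (m := ENNReal.ofReal (√(1 - 2 * ((1 / 16) / (1 / 2) ^ k) * mildVar t ((1 / 2) ^ k)))⁻¹)
    ENNReal.ofReal_ne_top ?_
  filter_upwards [ae_isWienerIntegral_pair hgW (h := (1 / 2) ^ k) (by positivity)] with x hx
  exact lintegral_exp_increment hW ht hg (by positivity) hx.1 hx.2 (abs_of_pos (by norm_num))

theorem ae_memBesovOrlicz (hW : IsSpaceTimeWhiteNoise W P) {t : ℝ} (ht : 0 < t)
    {g : ℝ × Ω → ℝ} (hg : Measurable g)
    (hgW : ∀ᵐ x ∂volume.restrict (Icc (0 : ℝ) 1),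
      IsWienerIntegral W P (mildKernel t x) fun ω => g (x, ω)) :
    ∀ᵐ ω ∂P, MemBesovOrlicz (1 / 2) (fun x => g (x, ω)) (Icc 0 1) := by
  obtain ⟨a, ha0, ha⟩ := lintegral_exp_sq_ae_ne_top hW ht hg hgW
  filter_upwards [ha, dyadicExpAverage_ae_ne_top hW ht hg hgW,
    ae_tendsto_dyadicExpAverage_sub hW ht hg hgW (a := 1 / 16) (abs_of_pos (by norm_num))]
    with ω h1 h2 h3
  obtain ⟨C, hC⟩ := h3.bddAbove_range
  have hmean : ∀ k, dyadicExpMean t (1 / 16) k ≤ 2 := by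
    intro k
    have hh : (0 : ℝ) < (1 / 2) ^ k := by positivity
    have hh1 : (1 / 2 : ℝ) ^ k ≤ 1 := pow_le_one₀ (by norm_num) (by norm_num)
    have hv := mildVar_le ht hh.le
    unfold dyadicExpMean
    generalize (1 / 2 : ℝ) ^ k = h at *
    have h4 : 2 * (1 / 16 / h) * mildVar t h ≤ 1 / 8 := by
      calc 2 * (1 / 16 / h) * mildVar t h ≤ 2 * (1 / 16 / h) * h := by gcongr
        _ = 1 / 8 := by field_simp; norm_num
    have h5 : 1 / 2 ≤ √(1 - 2 * (1 / 16 / h) * mildVar t h) :=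
      Real.le_sqrt_of_sq_le (by linarith)
    calc _ ≤ 1 * (1 / 2 : ℝ)⁻¹ := by gcongr; linarith
      _ = 2 := by norm_num
  have hbound : ∀ k, dyadicExpAverage g (1 / 16) k ω ≤ ENNReal.ofReal (C + 2) := by
    intro k
    rw [← ENNReal.ofReal_toReal (h2 k)]
    refine ENNReal.ofReal_le_ofReal ?_
    have := hC (mem_range_self k)
    linarith [hmean k]
  refine memBesovOrlicz_of_lintegral_exp_le (f := fun x => g (x, ω))
    -- One rate has to serve both the function and its increments, hence the minimum.
    (hg.comp measurable_prodMk_right) (a := min a (1 / 16)) (lt_min ha0 (by norm_num))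
    (M := (∫⁻ x in Icc 0 1, ENNReal.ofReal (Real.exp (a * g (x, ω) ^ 2))) +
      ENNReal.ofReal (C + 2)) (by finiteness) ?_ ?_
  · refine le_trans (lintegral_mono fun x => ?_) le_self_add
    gcongr
    exact min_le_left _ _
  · intro k _
    refine le_trans (lintegral_mono fun x => ?_) ((hbound k).trans le_add_self)
    have e : (1 / 16 : ℝ) / (1 / 2) ^ k = 1 / 16 * 2 ^ k := by
      rw [one_div 2, inv_pow, div_inv_eq_mul]
    rw [e]
    gcongr
    exact min_le_right _ _

theorem ae_not_memBesovOrliczZero (hW : IsSpaceTimeWhiteNoise W P) {t : ℝ} (ht : 0 < t)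
    {g : ℝ × Ω → ℝ} (hg : Measurable g)
    (hgW : ∀ᵐ x ∂volume.restrict (Icc (0 : ℝ) 1),
      IsWienerIntegral W P (mildKernel t x) fun ω => g (x, ω)) :
    ∀ᵐ ω ∂P, ¬ MemBesovOrliczZero (1 / 2) (fun x => g (x, ω)) (Icc 0 1) := by
  filter_upwards [ae_tendsto_dyadicExpAverage_sub hW ht hg hgW (a := -(1 / 16)) (by norm_num)]
    with ω h3
  -- Constants: the mean is at most `(98/100)(1 - h)` with `1 - h > 1/2`, leaving a gap of `1/100`;
  -- the fluctuation takes at most `1/200` of it. Mean squares below `h/20` would allow a gap of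
  -- only `(1/16)(1/20) = 1/320 < 1/200`.
  refine not_memBesovOrliczZero_of_le_lintegral_sq (δ := 1 / 20) (by norm_num) ?_
  have hsmall : ∀ᶠ k : ℕ in atTop, 2 * heatBound t * (1 / 2 : ℝ) ^ k < 1 / 2 := by
    have := tendsto_half_pow.const_mul (2 * heatBound t)
    rw [mul_zero] at this
    exact this.eventually_lt_const (by norm_num)
  filter_upwards [hsmall, tendsto_half_pow.eventually_lt_const (by norm_num : (0 : ℝ) < 1 / 2),
    h3.eventually_lt_const (by norm_num : (0 : ℝ) < 1 / 200)] with k hk1 hk2 hk3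
  have hh : (0 : ℝ) < (1 / 2) ^ k := by positivity
  have hv := mildVar_ge ht ((1 / 2) ^ k)
  unfold dyadicExpMean dyadicExpAverage at hk3
  generalize (1 / 2 : ℝ) ^ k = h at *
  have hvar : h / 2 ≤ mildVar t h := by
    have : 2 * (2 * √Real.pi * √t)⁻¹ * h ^ 2 = (2 * heatBound t * h) * h := by
      rw [heatBound]; ring
    nlinarith
  have h4 : 1 / 16 ≤ -(2 * (-(1 / 16) / h) * mildVar t h) := by
    calc (1 / 16 : ℝ) = 2 * (1 / 16 / h) * (h / 2) := by field_simp
      _ ≤ 2 * (1 / 16 / h) * mildVar t h := by gcongr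
      _ = _ := by ring
  have h5 : (√(1 - 2 * (-(1 / 16) / h) * mildVar t h))⁻¹ ≤ 98 / 100 := by
    refine inv_le_of_inv_le₀ (by norm_num) (Real.le_sqrt_of_sq_le ?_)
    refine le_trans ?_ (by linarith : (17 / 16 : ℝ) ≤ _)
    norm_num
  set Y := ∫⁻ x in Icc 0 (1 - h),
    ENNReal.ofReal (Real.exp (-(1 / 16) / h * (g (x + h, ω) - g (x, ω)) ^ 2)) with hY
  have hYle : Y ≤ ENNReal.ofReal (1 - h) := by
    calc Y ≤ ∫⁻ _ in Icc 0 (1 - h), 1 := by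
          refine lintegral_mono fun x => ENNReal.ofReal_le_one.2 (Real.exp_le_one_iff.2 ?_)
          rw [neg_div, neg_mul]
          exact neg_nonpos.2 (by positivity)
      _ = _ := by simp
  have hYfin : Y ≠ ∞ := ne_top_of_le_ne_top ENNReal.ofReal_ne_top hYle
  have hmeas : Measurable fun x => ENNReal.ofReal
      (Real.exp (-(1 / 16) / h * (g (x + h, ω) - g (x, ω)) ^ 2)) := by
    have h1 : Measurable fun x => g (x + h, ω) :=
      hg.comp ((measurable_id.add_const h).prodMk measurable_const)
    have h2 : Measurable fun x => g (x, ω) := hg.comp measurable_prodMk_right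
    fun_prop
  -- Integrated form of `1 ≤ y + exp (-y)` with `y` the squared increment over `16 h`.
  have hlow : ENNReal.ofReal (1 - h) ≤ ENNReal.ofReal (1 / (16 * h)) *
      (∫⁻ x in Icc 0 (1 - h), ENNReal.ofReal ((g (x + h, ω) - g (x, ω)) ^ 2)) + Y := by
    rw [← lintegral_const_mul' _ _ ENNReal.ofReal_ne_top, hY, ← lintegral_add_right _ hmeas]
    calc ENNReal.ofReal (1 - h) = ∫⁻ _ in Icc 0 (1 - h), 1 := by simp
      _ ≤ _ := by
        refine lintegral_mono fun x => ?_
        rw [← ENNReal.ofReal_mul (by positivity),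
          ← ENNReal.ofReal_add (by positivity) (by positivity), ← ENNReal.ofReal_one]
        refine ENNReal.ofReal_le_ofReal ?_
        have := Real.add_one_le_exp (-(1 / 16) / h * (g (x + h, ω) - g (x, ω)) ^ 2)
        have e : 1 / (16 * h) * (g (x + h, ω) - g (x, ω)) ^ 2 =
          -(-(1 / 16) / h * (g (x + h, ω) - g (x, ω)) ^ 2) := by field_simp
        linarith
  have hYr : Y.toReal ≤ (1 - h) - 1 / 200 := by
    have : (1 - h) * (√(1 - 2 * (-(1 / 16) / h) * mildVar t h))⁻¹ ≤ (1 - h) * (98 / 100) :=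
      mul_le_mul_of_nonneg_left h5 (by linarith)
    linarith
  by_contra hcon
  rw [not_le] at hcon
  have hup : ENNReal.ofReal (1 - h) ≤ ENNReal.ofReal (1 / 320 + Y.toReal) := by
    refine hlow.trans ?_
    rw [ENNReal.ofReal_add (by norm_num) ENNReal.toReal_nonneg, ENNReal.ofReal_toReal hYfin]
    gcongr
    calc _ ≤ ENNReal.ofReal (1 / (16 * h)) * ENNReal.ofReal (1 / 20 * h) := by gcongr
      _ = _ := by
        rw [← ENNReal.ofReal_mul (by positivity)]
        congr 1; field_simp; norm_num
  rw [ENNReal.ofReal_le_ofReal_iff (by positivity)] at hup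
  linarith

end Field

/-! ### Transfer to the given version of the solution -/

theorem theorem2p4 {Ω : Type*} [MeasurableSpace Ω] (P : Measure Ω) [IsProbabilityMeasure P]
    (W : ℝ≥0 → BddBorelSet → Ω → ℝ) (hW : IsSpaceTimeWhiteNoise W P)
    (T : ℝ) (u : ℝ → ℝ → Ω → ℝ) (hu : IsMildSolution W P T u)
    (t : ℝ) (ht : t ∈ Ioc (0 : ℝ) T)
    (hmeas : AEMeasurable (fun z : ℝ × Ω => u t z.1 z.2)
      ((volume.restrict (Icc (0 : ℝ) 1)).prod P)) :
    (∀ᵐ ω ∂P, MemBesovOrlicz (1 / 2) (fun x => u t x ω) (Icc 0 1)) ∧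
    (∀ᵐ ω ∂P, ¬ MemBesovOrliczZero (1 / 2) (fun x => u t x ω) (Icc 0 1)) := by
  have hg := hmeas.measurable_mk
  have hae := hmeas.ae_eq_mk
  set g := hmeas.mk with hgdef
  -- Fubini in both orders: `h1` makes `g (x, ·)` a Wiener integral for almost every `x`, and `h2`
  -- lets membership pass between the paths of `g` and `u`.
  have h1 : ∀ᵐ x ∂volume.restrict (Icc (0 : ℝ) 1), ∀ᵐ ω ∂P, u t x ω = g (x, ω) :=
    Measure.ae_ae_of_ae_prod hae
  have h2 : ∀ᵐ ω ∂P, ∀ᵐ x ∂volume.restrict (Icc (0 : ℝ) 1), u t x ω = g (x, ω) :=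
    Measure.ae_ae_of_ae_prod (p := fun z : Ω × ℝ => u t z.2 z.1 = g (z.2, z.1))
      (Measure.measurePreserving_swap.quasiMeasurePreserving.ae hae)
  have hgW : ∀ᵐ x ∂volume.restrict (Icc (0 : ℝ) 1),
      IsWienerIntegral W P (mildKernel t x) fun ω => g (x, ω) := by
    filter_upwards [h1] with x hx
    exact (hu t ⟨ht.1.le, ht.2⟩ x).congr_ae hx
  constructor
  · filter_upwards [h2, ae_memBesovOrlicz hW ht.1 hg hgW] with ω hω h
    exact (memBesovOrlicz_congr measurableSet_Icc hω _).2 h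
  · filter_upwards [h2, ae_not_memBesovOrliczZero hW ht.1 hg hgW] with ω hω h
    rwa [memBesovOrliczZero_congr measurableSet_Icc hω]
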